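/- Throughout, "smooth" means $C^\infty$, a diffeomorphism $\lambda$ between open subsets of $\mathbb R^n$ has domain $\operatorname{dom}\lambda$ and codomain $\operatorname{cod}\lambda$, and $\operatorname{germ}_x\lambda$ is its germ at $x$. **Objects.** Let $X$ be a paracompact, second countable, Hausdorff space. A *reduced orbifold chart* of dimension $n$ on $X$ is a triple $(\tilde X,G,\pi)$: a connected (non-empty) open set $\tilde X\subseteq\mathbb R^n$, a finite group $G$ of smooth automorphisms of $\tilde X$, and a continuous $G$-invariant map $\pi:\tilde X\to X$ with open image inducing a homeomorphism $\tilde X/G\cong\pi(\tilde X)$. A *change of charts* from $(\tilde X_1,G_1,\pi_1)$ to $(\tilde X_2,G_2,\pi_2)$ is a diffeomorphism $\lambda$ from a connected component of $\pi_1^{-1}(Y)$, for some non-empty open $Y\subseteq\pi_1(\tilde X_1)$, onto an open subset of $\tilde X_2$, with $\pi_2\circ\lambda=\pi_1$ on $\operatorname{dom}\lambda$. A *reduced orbifold atlas* $\mathcal X$ of dimension $n$ on $X$ is a family $(\tilde X_i,G_i,\pi_i)_{i\in I}$ of charts of dimension $n$ such that the $\pi_i(\tilde X_i)$ cover $X$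 and for all $i,i'$ and $x\in\tilde X_i$, $x'\in\tilde X_{i'}$ with $\pi_i(x)=\pi_{i'}(x')$ there is a change of charts $\lambda$ from the $i$-th to the $i'$-th chart with $x\in\operatorname{dom}\lambda$. The set of all changes of charts from the $i$-th to the $i'$-th chart is $\mathrm{Ch}(\mathcal X,i,i')$; source and target chart are part of the data of a change of charts and of its germs, and $\mathrm{Ch}(\mathcal X)=\coprod_{i,i'}\mathrm{Ch}(\mathcal X,i,i')$. A subset $P\subseteq \mathrm{Ch}(\mathcal X)$, with $P(i,i')=P\cap \mathrm{Ch}(\mathcal X,i,i')$, is *good* if for all $\lambda\in \mathrm{Ch}(\mathcal X,i,i')$ and $x\in\operatorname{dom}\lambda$ there is $\hat\lambda\in P(i,i')$ with $x\in\operatorname{dom}\hat\lambda$ and the same germ at $x$. **Morphisms.** Let $\mathcal X=(\tilde X_i,G_i,\pi_i)_{i\in I}$ and $\mathcal Y=(\tilde Y_j,H_j,\chi_j)_{j\in J}$ be atlases on $X$ and $Y$. A *representative of a morphism* $\mathcal X\to\mathcal Y$ is a tuple $(f,\bar f,\{\tilde f_i\}_{i\in I},P_f,\nu_f)$: a continuous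 map $f:X\to Y$; a map $\bar f:I\to J$; smooth maps $\tilde f_i:\tilde X_i\to\tilde Y_{\bar f(i)}$ with $\chi_{\bar f(i)}\circ\tilde f_i=f\circ\pi_i$; a good subset $P_f\subseteq \mathrm{Ch}(\mathcal X)$; and maps $\nu_f:P_f(i,i')\to \mathrm{Ch}(\mathcal Y,\bar f(i),\bar f(i'))$ such that $\tilde f_i(\operatorname{dom}\lambda)\subseteq\operatorname{dom}\nu_f(\lambda)$, $\tilde f_{i'}(\operatorname{cod}\lambda)\subseteq\operatorname{cod}\nu_f(\lambda)$ and $\tilde f_{i'}\circ\lambda=\nu_f(\lambda)\circ\tilde f_i$ on $\operatorname{dom}\lambda$ for $\lambda\in P_f(i,i')$, and such that $\nu_f$ is compatible with germs: (d) if $\lambda,\lambda'\in P_f(i,i')$ have the same germ at $x$, then $\nu_f(\lambda),\nu_f(\lambda')$ have the same germ at $\tilde f_i(x)$; (e) if $\lambda_1\in P_f(i,i')$, $\lambda_2\in P_f(i',i'')$, $\lambda_3\in P_f(i,i'')$ and $\operatorname{germ}_x\lambda_3=\operatorname{germ}_x(\lambda_2\circ\lambda_1)$, then $\nu_f(\lambda_3)$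 and $\nu_f(\lambda_2)\circ\nu_f(\lambda_1)$ have the same germ at $\tilde f_i(x)$; (f) if $\lambda\in P_f(i,i)$ has the germ of the identity at $x$, then $\nu_f(\lambda)$ has the germ of the identity at $\tilde f_i(x)$. Two representatives are *equivalent* if they have the same $f,\bar f,\tilde f_i$ and, whenever $\lambda\in P_f(i,i')$, $\lambda'\in P_{f'}(i,i')$ have the same germ at $x$, $\nu_f(\lambda)$ and $\nu_{f'}(\lambda')$ have the same germ at $\tilde f_i(x)$. A *morphism* $[\hat f]$ is an equivalence class. The identity of $\mathcal X$ is the class of $(\mathrm{id}_X,\mathrm{id}_I,\{\mathrm{id}_{\tilde X_i}\},\mathrm{Ch}(\mathcal X),\mathrm{id})$. The composition $[\hat g]\circ[\hat f]$ is the class with data $g\circ f$, $\bar g\circ\bar f$, $\tilde g_{\bar f(i)}\circ\tilde f_i$, where $P_{g\circ f}$ is a good set of restrictions $\lambda'\in\mathrm{Ch}(\mathcal X,i,i')$ of elements $\lambda\in P_f(i,i')$ for which there is $\omega\in P_g(\bar f(i),\bar f(i'))$ agreeing with $\nu_f(\lambda)$ on an open set containing $\tilde f_i(\operatorname{dom}\lambda')$,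 and $\nu_{g\circ f}(\lambda')=\nu_g(\omega)$ for a choice of such an $\omega$. **2-morphisms.** Let $[\hat f^1],[\hat f^2]:\mathcal X\to\mathcal Y$ be morphisms over the same continuous map. A *representative of a 2-morphism* $[\hat f^1]\Rightarrow[\hat f^2]$ is a collection $\delta=\{(\tilde X_i^a,\delta_i^a)\}_{i\in I,a\in A(i)}$ such that for each $i$ the $\tilde X_i^a$ form an open covering of $\tilde X_i$; $\delta_i^a\in \mathrm{Ch}(\mathcal Y,\bar f^1(i),\bar f^2(i))$, $\tilde f_i^1(\tilde X_i^a)\subseteq\operatorname{dom}\delta_i^a$, $\tilde f_i^2(\tilde X_i^a)\subseteq\operatorname{cod}\delta_i^a$, and $\tilde f_i^2=\delta_i^a\circ\tilde f_i^1$ on $\tilde X_i^a$; $\delta_i^a$ and $\delta_i^{a'}$ have the same germ at $\tilde f_i^1(x)$ for $x\in\tilde X_i^a\cap\tilde X_i^{a'}$; and for all $\lambda\in \mathrm{Ch}(\mathcal X,i,i')$ and $x\in\operatorname{dom}\lambda\cap\tilde X_i^a$ with $\lambda(x)\in\tilde X_{i'}^{a'}$ there are representatives $(P_{f^m},\nu_{f^m})$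 of the two classes and $\lambda^m\in P_{f^m}(i,i')$ with $\operatorname{germ}_x\lambda^m=\operatorname{germ}_x\lambda$ ($m=1,2$), such that $\nu_{f^2}(\lambda^2)\circ\delta_i^a$ and $\delta_{i'}^{a'}\circ\nu_{f^1}(\lambda^1)$ have the same germ at $\tilde f_i^1(x)$. Two representatives $\delta,\bar\delta$ are *equivalent* if $\delta_i^a$ and $\bar\delta_i^{\bar a}$ have the same germ at $\tilde f^1_i(x)$ for all $x\in\tilde X_i^a\cap\tilde X_i^{\bar a}$. A *2-morphism* is an equivalence class $[\delta]$; there are none between morphisms over different continuous maps. The 2-identity of $[\hat f]$ is the class of $\{(\tilde X_i,\mathrm{id}_{\tilde Y_{\bar f(i)}})\}_{i\in I}$. The *vertical composition* $[\sigma]\odot[\delta]$ of $[\delta]:[\hat f^1]\Rightarrow[\hat f^2]$ and $[\sigma]:[\hat f^2]\Rightarrow[\hat f^3]$ is the class of a collection of pairs consisting of an open subset $W$ of some $\tilde X_i^a\cap\tilde X_i^b$ and of a change of charts whose domain contains $\tilde f_i^1(W)$ and which is a restriction of $\sigma_i^b\circ\delta_i^a$, the sets $W$ covering $\tilde X_i$.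 The *horizontal composition* $[\xi]*[\delta]:[\hat g^1]\circ[\hat f^1]\Rightarrow[\hat g^2]\circ[\hat f^2]$ of $[\delta]:[\hat f^1]\Rightarrow[\hat f^2]:\mathcal X\to\mathcal Y$ and $[\xi]=[\{(\tilde Y_j^c,\xi_j^c)\}]:[\hat g^1]\Rightarrow[\hat g^2]:\mathcal Y\to\mathcal Z$ is the class of a collection of pairs consisting of an open set $W\subseteq\tilde X_i^a\cap(\tilde f_i^2)^{-1}(\tilde Y^c_{\bar f^2(i)})$ and of a change of charts whose domain contains $\tilde g^1_{\bar f^1(i)}(\tilde f_i^1(W))$ and which is a restriction of $\xi^c_{\bar f^2(i)}\circ\nu_{g^1}(\tilde\delta_i^a)$, where $\tilde\delta_i^a\in P_{g^1}(\bar f^1(i),\bar f^2(i))$ agrees with $\delta_i^a$ on an open set containing $\tilde f_i^1(W)$, the sets $W$ covering $\tilde X_i$. The operations $\circ$, $\odot$ and $*$ do not depend on the choices made. **Proposition.** Reduced orbifold atlases, their morphisms and 2-morphisms, with the compositions $\circ,\odot,*$ and the above identities, form a (strict) 2-category $\mathbf{RedAtl}$. In particular the interchange law $$([\eta]\odot[\xi])*([\sigma]\odot[\delta])=([\eta]*[\sigma])\odot([\xi]*[\delta])$$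 holds for all $[\delta]:[\hat f^1]\Rightarrow[\hat f^2]$, $[\sigma]:[\hat f^2]\Rightarrow[\hat f^3]$ between morphisms $\mathcal X\to\mathcal Y$ and $[\xi]:[\hat g^1]\Rightarrow[\hat g^2]$, $[\eta]:[\hat g^2]\Rightarrow[\hat g^3]$ between morphisms $\mathcal Y\to\mathcal Z$. -/

import Mathlib

open Set Filter Topology
open scoped ContDiff

noncomputable section

namespace Orbifold

universe u

/-! ## Diffeomorphisms between open subsets of `ℝⁿ` -/

/-- The model space `ℝⁿ`. -/
abbrev E (n : ℕ) : Type := EuclideanSpace ℝ (Fin n)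

/-- A smooth diffeomorphism between two open subsets `source` and `target` of `ℝⁿ`. Lean functions
are total; the map and its inverse are extended by the identity outside of `source` and `target`,
so that two such diffeomorphisms are equal as soon as they have the same domain and the same values
on it, and no information outside of the domain is recorded. -/
structure PDiffeo (n : ℕ) extends OpenPartialHomeomorph (E n) (E n) where
  smooth : ContDiffOn ℝ ∞ toOpenPartialHomeomorph source
  smooth_symm : ContDiffOn ℝ ∞ toOpenPartialHomeomorph.symm target
  off_source : ∀ x, x ∉ source → toOpenPartialHomeomorph x = x
  off_target : ∀ x, x ∉ target → toOpenPartialHomeomorph.symm x = x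

instance (n : ℕ) : CoeFun (PDiffeo n) (fun _ => E n → E n) :=
  ⟨fun l => l.toOpenPartialHomeomorph⟩

namespace PDiffeo

variable {n : ℕ}

theorem ext' {l m : PDiffeo n} (h : l.source = m.source) (h' : EqOn l m l.source) : l = m := by
  have e : l.toOpenPartialHomeomorph = m.toOpenPartialHomeomorph := by
    have hfun : ∀ x, l x = m x := by
      intro x
      by_cases hx : x ∈ l.source
      · exact h' hx
      · rw [l.off_source x hx, m.off_source x (h ▸ hx)]
    have ht : l.target = m.target := by
      rw [← l.toOpenPartialHomeomorph.image_source_eq_target,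
        ← m.toOpenPartialHomeomorph.image_source_eq_target, ← h]
      exact h'.image_eq
    refine OpenPartialHomeomorph.ext _ _ hfun (fun y => ?_) h
    by_cases hy : y ∈ l.target
    · have h1 : l.toOpenPartialHomeomorph.symm y ∈ l.source :=
        l.toOpenPartialHomeomorph.map_target hy
      have h2 : m (l.toOpenPartialHomeomorph.symm y) = y := by
        rw [← h' h1]; exact l.toOpenPartialHomeomorph.right_inv hy
      have h3 := m.toOpenPartialHomeomorph.left_inv (h ▸ h1)
      rw [← h3]
      exact congrArg _ h2
    · rw [l.off_target y hy, m.off_target y (ht ▸ hy)]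
  cases l; cases m; cases e; rfl

open scoped Classical in
/-- Extend a smooth diffeomorphism between open sets by the identity. -/
def ofHomeo (e : OpenPartialHomeomorph (E n) (E n)) (h : ContDiffOn ℝ ∞ e e.source)
    (h' : ContDiffOn ℝ ∞ e.symm e.target) : PDiffeo n where
  toFun x := if x ∈ e.source then e x else x
  invFun x := if x ∈ e.target then e.symm x else x
  source := e.source
  target := e.target
  map_source' x hx := by simp [hx]
  map_target' x hx := by simp [hx]
  left_inv' x hx := by simp [hx]
  right_inv' x hx := by simp [hx]
  open_source := e.open_source
  open_target := e.open_target
  continuousOn_toFun := e.continuousOn.congr (fun _ hx => if_pos hx)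
  continuousOn_invFun := e.symm.continuousOn.congr (fun _ hx => if_pos hx)
  smooth := h.congr (fun _ hx => if_pos hx)
  smooth_symm := h'.congr (fun _ hx => if_pos hx)
  off_source _ hx := if_neg hx
  off_target _ hx := if_neg hx

theorem ofHomeo_source (e : OpenPartialHomeomorph (E n) (E n)) (h h') :
    (ofHomeo e h h').source = e.source := rfl

theorem ofHomeo_apply (e : OpenPartialHomeomorph (E n) (E n)) (h h') {x : E n}
    (hx : x ∈ e.source) : ofHomeo e h h' x = e x := if_pos hx

/-- The identity of an open set. -/
def idOn (U : Set (E n)) (hU : IsOpen U) : PDiffeo n :=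
  ofHomeo (OpenPartialHomeomorph.ofSet U hU) contDiffOn_id contDiffOn_id

theorem idOn_apply (U : Set (E n)) (hU : IsOpen U) (x : E n) : idOn U hU x = x := by
  by_cases hx : x ∈ (OpenPartialHomeomorph.ofSet U hU).source
  · exact ofHomeo_apply _ _ _ hx
  · exact (idOn U hU).off_source x hx

theorem mem_nhds (l : PDiffeo n) {x : E n} (hx : x ∈ l.source) : l.source ∈ 𝓝 x :=
  l.open_source.mem_nhds hx

theorem continuousAt (l : PDiffeo n) {x : E n} (hx : x ∈ l.source) : ContinuousAt l x :=
  l.toOpenPartialHomeomorph.continuousAt hx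

/-- Restriction to a smaller open set. -/
def restrict (l : PDiffeo n) (U : Set (E n)) (hU : IsOpen U) : PDiffeo n :=
  ofHomeo (l.toOpenPartialHomeomorph.restrOpen U hU)
    (l.smooth.mono (by intro x hx; simp at hx; exact hx.1))
    (l.smooth_symm.mono (by intro x hx; simp at hx; exact hx.1))

theorem restrict_source (l : PDiffeo n) (U : Set (E n)) (hU : IsOpen U) :
    (l.restrict U hU).source = l.source ∩ U := rfl

theorem restrict_apply (l : PDiffeo n) (U : Set (E n)) (hU : IsOpen U) {x : E n}
    (hx : x ∈ l.source ∩ U) : l.restrict U hU x = l x :=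
  ofHomeo_apply _ _ _ hx

/-- The composition `m ∘ l`, defined on `l⁻¹(dom m)`. -/
def trans (l m : PDiffeo n) : PDiffeo n :=
  ofHomeo (l.toOpenPartialHomeomorph.trans m.toOpenPartialHomeomorph)
    (m.smooth.comp (l.smooth.mono (by intro x hx; simp at hx; exact hx.1))
      (by intro x hx; simp at hx; exact hx.2))
    (l.smooth_symm.comp (m.smooth_symm.mono (by intro x hx; simp at hx; exact hx.1))
      (by intro x hx; simp at hx; exact hx.2))

theorem mem_trans_source (l m : PDiffeo n) {x : E n} :
    x ∈ (l.trans m).source ↔ x ∈ l.source ∧ l x ∈ m.source := Iff.rfl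

theorem trans_apply (l m : PDiffeo n) {x : E n} (hx : x ∈ l.source) (hx' : l x ∈ m.source) :
    l.trans m x = m (l x) :=
  ofHomeo_apply _ _ _ ⟨hx, hx'⟩

end PDiffeo

/-! ## Charts, changes of charts, atlases -/

/-- A reduced orbifold chart of dimension `n` for the non-empty open subset `range proj` of `X`.
A smooth automorphism of `dom` is recorded as a permutation of `ℝⁿ` which is the identity outside
of `dom`; as `G` is a group of such automorphisms, its action on `dom` is effective. -/
structure Chart (X : Type u) [TopologicalSpace X] (n : ℕ) where
  /-- the connected open subset `X̃` of `ℝⁿ` -/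
  dom : Set (E n)
  isOpen_dom : IsOpen dom
  isConnected_dom : IsConnected dom
  /-- the finite group `G` of smooth automorphisms of `X̃` -/
  G : Subgroup (Equiv.Perm (E n))
  finite_G : Finite G
  G_off : ∀ g ∈ G, ∀ x, x ∉ dom → g x = x
  G_smooth : ∀ g ∈ G, ContDiffOn ℝ ∞ g dom
  /-- the projection `π : X̃ → X` -/
  proj : dom → X
  continuous_proj : Continuous proj
  isOpen_range : IsOpen (range proj)
  /-- the fibres of `π` are exactly the `G`-orbits ... -/
  proj_eq_iff : ∀ x y : dom, proj x = proj y ↔ ∃ g ∈ G, g x = y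
  /-- ... and `π` is a quotient map onto its image, i.e. `X̃ / G → π(X̃)` is a homeomorphism. -/
  isQuotientMap_proj : IsQuotientMap (Set.rangeFactorization proj)

namespace Chart

variable {X : Type u} [TopologicalSpace X] {n : ℕ}

/-- The preimage `π⁻¹(Y)`, as a subset of `ℝⁿ`. -/
def preim (c : Chart X n) (Y : Set X) : Set (E n) := Subtype.val '' (c.proj ⁻¹' Y)

theorem mem_preim (c : Chart X n) {Y : Set X} {x : E n} :
    x ∈ c.preim Y ↔ ∃ hx : x ∈ c.dom, c.proj ⟨x, hx⟩ ∈ Y := by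
  simp [preim]

theorem preim_subset (c : Chart X n) (Y : Set X) : c.preim Y ⊆ c.dom := by
  rintro _ ⟨x, _, rfl⟩; exact x.2

theorem isOpen_preim (c : Chart X n) {Y : Set X} (hY : IsOpen Y) : IsOpen (c.preim Y) :=
  c.isOpen_dom.isOpenMap_subtype_val _ (hY.preimage c.continuous_proj)

theorem G_mem (c : Chart X n) {g : Equiv.Perm (E n)} (hg : g ∈ c.G) {x : E n} (hx : x ∈ c.dom) :
    g x ∈ c.dom := by
  by_contra h
  have h1 : g x = x := g.injective (c.G_off g hg _ h)
  exact h (by rwa [h1])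

/-- Around every point there are arbitrarily small components of preimages of open sets. -/
theorem exists_small (c : Chart X n) {x : E n} (hx : x ∈ c.dom) {U : Set (E n)} (hU : U ∈ 𝓝 x) :
    ∃ Y : Set X, IsOpen Y ∧ Y ⊆ range c.proj ∧ x ∈ c.preim Y ∧
      connectedComponentIn (c.preim Y) x ⊆ U := by
  classical
  have := c.finite_G
  obtain ⟨U', hU'U, hU', hxU'⟩ := mem_nhds_iff.1 hU
  -- the finite set of the points of the orbit that differ from `x`
  set S : Set (E n) := {y | ∃ g : c.G, g.1 x = y ∧ y ≠ x} with hS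
  have hSfin : S.Finite := by
    refine (Set.finite_range (fun g : c.G => g.1 x)).subset ?_
    rintro y ⟨g, rfl, _⟩; exact ⟨g, rfl⟩
  have hd : Disjoint ({x} : Set (E n)) S := by
    rw [Set.disjoint_singleton_left]; rintro ⟨g, _, h⟩; exact h rfl
  obtain ⟨N, M, hN, hM, hxN, hSM, hNM⟩ :=
    SeparatedNhds.of_isCompact_isCompact isCompact_singleton hSfin.isCompact hd
  have hcont : ∀ g : c.G, ContinuousAt g.1 x := fun g =>
    ((c.G_smooth g.1 g.2).continuousOn.continuousAt (c.isOpen_dom.mem_nhds hx))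
  have hW : ∀ᶠ y in 𝓝 x, y ∈ c.dom ∧ ∀ g : c.G, g.1 y ∈ (N ∩ U') ∪ M := by
    refine (c.isOpen_dom.eventually_mem hx).and (eventually_all.2 fun g => ?_)
    refine (hcont g).eventually (((hN.inter hU').union hM).mem_nhds ?_)
    by_cases h : g.1 x = x
    · left; rw [h]; exact ⟨hxN rfl, hxU'⟩
    · right; exact hSM ⟨g, rfl, h⟩
  obtain ⟨V, hVW, hV, hxV⟩ := mem_nhds_iff.1 hW
  have hVd : V ⊆ c.dom := fun y hy => (hVW hy).1
  -- saturation of `V`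
  have hpre : Subtype.val ⁻¹' (⋃ g : c.G, (g.1 : E n → E n) ⁻¹' V) =
      c.proj ⁻¹' (c.proj '' (Subtype.val ⁻¹' V)) := by
    ext ⟨y, hy⟩
    simp only [mem_preimage, mem_iUnion, mem_image, Subtype.exists]
    constructor
    · rintro ⟨g, hg, h⟩
      exact ⟨g y, c.G_mem hg hy, h, ((c.proj_eq_iff _ _).2 ⟨g, hg, rfl⟩).symm⟩
    · rintro ⟨z, hz, hzV, h⟩
      obtain ⟨g, hg, h⟩ := (c.proj_eq_iff _ _).1 h.symm
      exact ⟨g, hg, by rw [h]; exact hzV⟩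
  have hopen : IsOpen (c.proj ⁻¹' (c.proj '' (Subtype.val ⁻¹' V))) := by
    rw [← hpre, preimage_iUnion]
    refine isOpen_iUnion fun g => ?_
    have hg : Continuous fun y : c.dom => g.1 (y : E n) :=
      (c.G_smooth g.1 g.2).continuousOn.domRestrict
    exact hV.preimage hg
  set Y : Set X := c.proj '' (Subtype.val ⁻¹' V) with hY
  have hYr : Y ⊆ range c.proj := image_subset_range _ _
  have hYopen : IsOpen Y := by
    have h1 : IsOpen ((Subtype.val : range c.proj → X) ⁻¹' Y) :=
      c.isQuotientMap_proj.isOpen_preimage.1 hopen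
    have h2 := c.isOpen_range.isOpenMap_subtype_val _ h1
    rwa [Subtype.image_preimage_coe, inter_eq_right.2 hYr] at h2
  have hxY : x ∈ c.preim Y := c.mem_preim.2 ⟨hx, ⟨⟨x, hx⟩, hxV, rfl⟩⟩
  refine ⟨Y, hYopen, hYr, hxY, ?_⟩
  have hsub : c.preim Y ⊆ (N ∩ U') ∪ M := by
    intro y hy
    obtain ⟨hyd, ⟨z, hz⟩, hzV, h⟩ := c.mem_preim.1 hy
    obtain ⟨g, hg, h⟩ := (c.proj_eq_iff _ _).1 h
    have := (hVW hzV).2 ⟨g, hg⟩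
    simp only at h this
    rwa [h] at this
  have := IsPreconnected.subset_left_of_subset_union (hN.inter hU') hM
    (hNM.mono_left inter_subset_left) ((connectedComponentIn_subset _ x).trans hsub)
    ⟨x, mem_connectedComponentIn hxY, hxN rfl, hxU'⟩ isPreconnected_connectedComponentIn
  exact fun y hy => hU'U (this hy).2

end Chart

section Change

variable {X : Type u} [TopologicalSpace X] {n : ℕ}

/-- `l` is a change of charts from `c` to `c'`. -/
structure IsChange (c c' : Chart X n) (l : PDiffeo n) : Prop where
  /-- `dom l` is a connected component of `π⁻¹(Y)`, for some non-empty open set `Y ⊆ π(X̃)` -/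
  component : ∃ Y : Set X, IsOpen Y ∧ Y.Nonempty ∧ Y ⊆ range c.proj ∧
    ∃ x ∈ c.preim Y, l.source = connectedComponentIn (c.preim Y) x
  target_subset : l.target ⊆ c'.dom
  /-- `π' ∘ l = π` on `dom l` -/
  proj_eq : ∀ x ∈ l.source, ∀ (hx : x ∈ c.dom) (hx' : l x ∈ c'.dom),
    c'.proj ⟨l x, hx'⟩ = c.proj ⟨x, hx⟩

variable {c c' c'' : Chart X n} {l m : PDiffeo n}

theorem IsChange.source_subset (h : IsChange c c' l) : l.source ⊆ c.dom := by
  obtain ⟨Y, _, _, _, x, _, hs⟩ := h.component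
  rw [hs]
  exact (connectedComponentIn_subset _ _).trans (c.preim_subset Y)

theorem IsChange.map_mem (h : IsChange c c' l) {x : E n} (hx : x ∈ l.source) : l x ∈ c'.dom :=
  h.target_subset (l.toOpenPartialHomeomorph.map_source hx)

/-- A diffeomorphism compatible with the projections restricts, around each point of its domain,
to arbitrarily small changes of charts. -/
theorem exists_change (hs : l.source ⊆ c.dom) (ht : MapsTo l l.source c'.dom)
    (hp : ∀ x ∈ l.source, ∀ (hx : x ∈ c.dom) (hx' : l x ∈ c'.dom),
      c'.proj ⟨l x, hx'⟩ = c.proj ⟨x, hx⟩)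
    {x : E n} (hx : x ∈ l.source) {U : Set (E n)} (hU : U ∈ 𝓝 x) :
    ∃ k, IsChange c c' k ∧ x ∈ k.source ∧ k.source ⊆ l.source ∩ U ∧ EqOn k l k.source := by
  obtain ⟨Y, hY, hYr, hxY, hsub⟩ :=
    c.exists_small (hs hx) (inter_mem (l.mem_nhds hx) hU)
  set W := connectedComponentIn (c.preim Y) x with hW
  have hWo : IsOpen W := (c.isOpen_preim hY).connectedComponentIn
  have hsrc : (l.restrict W hWo).source = W := by
    rw [PDiffeo.restrict_source]
    exact inter_eq_right.2 (hsub.trans inter_subset_left)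
  have happ : ∀ y ∈ W, l.restrict W hWo y = l y := fun y hy =>
    l.restrict_apply W hWo ⟨(hsub hy).1, hy⟩
  refine ⟨l.restrict W hWo, ⟨⟨Y, hY, ?_, hYr, x, hxY, hsrc⟩, ?_, ?_⟩, ?_, ?_, ?_⟩
  · obtain ⟨h, h'⟩ := c.mem_preim.1 hxY; exact ⟨_, h'⟩
  · rw [← (l.restrict W hWo).toOpenPartialHomeomorph.image_source_eq_target]
    rintro _ ⟨y, hy, rfl⟩
    rw [hsrc] at hy
    rw [happ y hy]
    exact ht (hsub hy).1
  · intro y hy hyd hyd'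
    rw [hsrc] at hy
    rw [← hp y (hsub hy).1 hyd (ht (hsub hy).1)]
    congr 1
    exact Subtype.ext (happ y hy)
  · rw [hsrc]; exact mem_connectedComponentIn hxY
  · rw [hsrc]; exact hsub
  · rw [hsrc]; exact happ

theorem IsChange.exists_restrict (h : IsChange c c' l) {x : E n} (hx : x ∈ l.source)
    {U : Set (E n)} (hU : U ∈ 𝓝 x) :
    ∃ k, IsChange c c' k ∧ x ∈ k.source ∧ k.source ⊆ l.source ∩ U ∧ EqOn k l k.source :=
  exists_change h.source_subset (fun _ hy => h.map_mem hy) h.proj_eq hx hU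

theorem IsChange.exists_comp (h : IsChange c c' l) (h' : IsChange c' c'' m) {x : E n}
    (hx : x ∈ l.source) (hx' : l x ∈ m.source) {U : Set (E n)} (hU : U ∈ 𝓝 x) :
    ∃ k, IsChange c c'' k ∧ x ∈ k.source ∧
      k.source ⊆ {y | y ∈ l.source ∧ l y ∈ m.source ∧ y ∈ U} ∧ EqOn k (m ∘ l) k.source := by
  obtain ⟨k, hk, hxk, hks, hke⟩ := exists_change (l := l.trans m) (c := c) (c' := c'')
    (fun y hy => h.source_subset hy.1)
    (fun y hy => by
      rw [PDiffeo.trans_apply l m hy.1 hy.2]; exact h'.map_mem hy.2)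
    (fun y hy hyd hyd' => by
      have hy' := (PDiffeo.mem_trans_source l m).1 hy
      have e := PDiffeo.trans_apply l m hy'.1 hy'.2
      rw [← h.proj_eq y hy'.1 hyd (h.map_mem hy'.1),
        ← h'.proj_eq (l y) hy'.2 (h.map_mem hy'.1) (h'.map_mem hy'.2)]
      congr 1
      exact Subtype.ext e)
    (x := x) ⟨hx, hx'⟩ hU
  refine ⟨k, hk, hxk, fun y hy => ⟨(hks hy).1.1, (hks hy).1.2, (hks hy).2⟩, fun y hy => ?_⟩
  rw [hke hy]
  exact PDiffeo.trans_apply l m (hks hy).1.1 (hks hy).1.2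

theorem isChange_idOn (c : Chart X n) : IsChange c c (PDiffeo.idOn c.dom c.isOpen_dom) where
  component := by
    obtain ⟨x, hx⟩ := c.isConnected_dom.nonempty
    have hp : c.preim (range c.proj) = c.dom := by
      rw [Chart.preim, preimage_range, image_univ, Subtype.range_coe]
    refine ⟨range c.proj, c.isOpen_range, ⟨_, ⟨x, hx⟩, rfl⟩, Subset.rfl, x, by rwa [hp], ?_⟩
    rw [hp]
    exact (c.isConnected_dom.isPreconnected.connectedComponentIn hx).symm
  target_subset := Subset.rfl
  proj_eq y _ hy hy' := by
    congr 1
    exact Subtype.ext (PDiffeo.idOn_apply _ _ y)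

end Change

/-- A reduced orbifold atlas, of some dimension `dim`, on some paracompact, second countable,
Hausdorff topological space. These are the objects of the 2-category. -/
structure RedAtl where
  space : Type u
  [topologicalSpace : TopologicalSpace space]
  [t2Space : T2Space space]
  [secondCountable : SecondCountableTopology space]
  [paracompact : ParacompactSpace space]
  dim : ℕ
  I : Type u
  chart : I → Chart space dim
  cover : ⋃ i, range (chart i).proj = univ
  /-- any two charts are compatible -/
  compatible : ∀ i i', ∀ (x : (chart i).dom) (x' : (chart i').dom),
    (chart i).proj x = (chart i').proj x' → ∃ l, IsChange (chart i) (chart i') l ∧ (x : E dim) ∈ l.source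

attribute [instance] RedAtl.topologicalSpace RedAtl.t2Space RedAtl.secondCountable
  RedAtl.paracompact

/-- The set of all changes of charts from the `i`-th to the `i'`-th chart of `X`. -/
def RedAtl.change (X : RedAtl.{u}) (i i' : X.I) : Set (PDiffeo X.dim) :=
  {l | IsChange (X.chart i) (X.chart i') l}

/-- The family `P(i, i')` is a good subset of the set of changes of charts of `X`. The source chart
`i` and the target chart `i'` are part of a change of charts and of its germs, so that germs are
compared only for changes with the same `i` and `i'`. -/
structure IsGood (X : RedAtl.{u}) (P : X.I → X.I → Set (PDiffeo X.dim)) : Prop where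
  subset : ∀ i i', P i i' ⊆ X.change i i'
  germ : ∀ i i', ∀ l ∈ X.change i i', ∀ x ∈ l.source,
    ∃ k ∈ P i i', x ∈ k.source ∧ l =ᶠ[𝓝 x] k

/-! ## Morphisms -/

/-- A representative of a morphism of reduced orbifold atlases. The map `lift i` is a smooth
map from the `i`-th chart of `X` to the `idx i`-th chart of `Y`; it is extended by `0`. -/
structure Rep (X Y : RedAtl.{u}) where
  base : C(X.space, Y.space)
  idx : X.I → Y.I
  lift : X.I → E X.dim → E Y.dim
  lift_off : ∀ i, ∀ x, x ∉ (X.chart i).dom → lift i x = 0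
  lift_mapsTo : ∀ i, MapsTo (lift i) (X.chart i).dom (Y.chart (idx i)).dom
  lift_smooth : ∀ i, ContDiffOn ℝ ∞ (lift i) (X.chart i).dom
  /-- `lift i` is a local lift of `base`; in particular `base` maps the image of the `i`-th chart
  into the image of the `idx i`-th chart -/
  lift_proj : ∀ i (x : (X.chart i).dom),
    (Y.chart (idx i)).proj ⟨lift i x, lift_mapsTo i x.2⟩ = base ((X.chart i).proj x)
  P : X.I → X.I → Set (PDiffeo X.dim)
  P_good : IsGood X P
  /-- `ν` maps each `l ∈ P(i, i')` to a change from the `idx i`-th to the `idx i'`-th chart -/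
  nu : ∀ {i i'}, P i i' → PDiffeo Y.dim
  nu_mem : ∀ {i i'} (l : P i i'), nu l ∈ Y.change (idx i) (idx i')
  nu_source : ∀ {i i'} (l : P i i'), MapsTo (lift i) l.1.source (nu l).source
  nu_target : ∀ {i i'} (l : P i i'), MapsTo (lift i') l.1.target (nu l).target
  nu_lift : ∀ {i i'} (l : P i i'), ∀ x ∈ l.1.source, lift i' (l.1 x) = nu l (lift i x)
  nu_germ : ∀ {i i'} (l l' : P i i'), ∀ x ∈ l.1.source ∩ l'.1.source, l.1 =ᶠ[𝓝 x] l'.1 →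
    nu l =ᶠ[𝓝 (lift i x)] nu l'
  nu_comp : ∀ {i i' i''} (l₁ : P i i') (l₂ : P i' i'') (l₃ : P i i''),
    ∀ x ∈ l₁.1.source, l₁.1 x ∈ l₂.1.source → x ∈ l₃.1.source → l₃.1 =ᶠ[𝓝 x] l₂.1 ∘ l₁.1 →
    nu l₂ ∘ nu l₁ =ᶠ[𝓝 (lift i x)] nu l₃
  nu_id : ∀ {i} (l : P i i), ∀ x ∈ l.1.source, l.1 =ᶠ[𝓝 x] id → nu l =ᶠ[𝓝 (lift i x)] id

/-- Equivalence of representatives of morphisms. -/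
structure Rep.Equiv {X Y : RedAtl.{u}} (F F' : Rep X Y) : Prop where
  base : F.base = F'.base
  idx : F.idx = F'.idx
  lift : F.lift = F'.lift
  germ : ∀ {i i'} (l : F.P i i') (l' : F'.P i i'), ∀ x ∈ l.1.source ∩ l'.1.source,
    l.1 =ᶠ[𝓝 x] l'.1 → F.nu l =ᶠ[𝓝 (F.lift i x)] F'.nu l'

instance Rep.setoid (X Y : RedAtl.{u}) : Setoid (Rep X Y) where
  r := Rep.Equiv
  iseqv :=
    { refl F := ⟨rfl, rfl, rfl, fun l l' x hx h => F.nu_germ l l' x hx h⟩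
      symm {F F'} h := ⟨h.base.symm, h.idx.symm, h.lift.symm, fun l l' x hx e => by
        rw [← h.lift]; exact (h.germ l' l x hx.symm e.symm).symm⟩
      trans {F F' F''} h h' := ⟨h.base.trans h'.base, h.idx.trans h'.idx, h.lift.trans h'.lift,
        fun {i i'} l l'' x hx e => by
          obtain ⟨k, hk, hxk, ek⟩ := F'.P_good.germ i i' l.1 (F.P_good.subset _ _ l.2) x hx.1
          have h1 := h.germ l ⟨k, hk⟩ x ⟨hx.1, hxk⟩ ek
          have h2 := h'.germ ⟨k, hk⟩ l'' x ⟨hxk, hx.2⟩ (ek.symm.trans e)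
          rw [← h.lift] at h2
          exact h1.trans h2⟩ }

/-- Morphisms of reduced orbifold atlases: equivalence classes of representatives. -/
def Mor (X Y : RedAtl.{u}) : Type u := Quotient (Rep.setoid X Y)

namespace Mor

variable {X Y Z : RedAtl.{u}}

/-- The class of a representative. -/
def mk (F : Rep X Y) : Mor X Y := Quotient.mk _ F

/-- The underlying continuous map. -/
def base (f : Mor X Y) : C(X.space, Y.space) :=
  Quotient.lift Rep.base (fun _ _ h => Rep.Equiv.base h) f

/-- The map between the sets of indices. -/
def idx (f : Mor X Y) : X.I → Y.I :=
  Quotient.lift Rep.idx (fun _ _ h => Rep.Equiv.idx h) f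

/-- The local lifts. -/
def lift (f : Mor X Y) : X.I → E X.dim → E Y.dim :=
  Quotient.lift Rep.lift (fun _ _ h => Rep.Equiv.lift h) f

theorem exists_rep (f : Mor X Y) : ∃ F, mk F = f := Quotient.exists_rep f

theorem exact {F F' : Rep X Y} (h : mk F = mk F') : F.Equiv F' := Quotient.exact h

theorem sound {F F' : Rep X Y} (h : F.Equiv F') : mk F = mk F' := Quotient.sound h

end Mor

/-- The identity morphism: all the data are identities and `P` is the set of all changes. -/
def Rep.id (X : RedAtl.{u}) : Rep X X where
  base := ContinuousMap.id _
  idx := _root_.id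
  lift i := (X.chart i).dom.indicator _root_.id
  lift_off i x hx := indicator_of_notMem hx _
  lift_mapsTo i x hx := by rw [indicator_of_mem hx]; exact hx
  lift_smooth i := contDiffOn_id.congr fun x hx => indicator_of_mem hx _
  lift_proj i x := by
    change _ = (X.chart i).proj x
    exact congrArg _ (Subtype.ext (indicator_of_mem x.2 _))
  P := X.change
  P_good := ⟨fun _ _ => Subset.rfl, fun _ _ l hl x hx => ⟨l, hl, hx, EventuallyEq.rfl⟩⟩
  nu l := l.1
  nu_mem l := l.2
  nu_source l x hx := by
    rw [indicator_of_mem (IsChange.source_subset l.2 hx)]; exact hx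
  nu_target l x hx := by
    rw [indicator_of_mem (IsChange.target_subset l.2 hx)]; exact hx
  nu_lift l x hx := by
    rw [indicator_of_mem (IsChange.source_subset l.2 hx),
      indicator_of_mem (IsChange.map_mem l.2 hx)]; rfl
  nu_germ l l' x hx h := by
    rw [indicator_of_mem (IsChange.source_subset l.2 hx.1)]; exact h
  nu_comp l₁ l₂ l₃ x hx _ _ h := by
    rw [indicator_of_mem (IsChange.source_subset l₁.2 hx)]; exact h.symm
  nu_id l x hx h := by
    rw [indicator_of_mem (IsChange.source_subset l.2 hx)]; exact h

/-- The identity of a reduced orbifold atlas. -/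
def Mor.id (X : RedAtl.{u}) : Mor X X := Mor.mk (Rep.id X)

section Comp

variable {X Y Z : RedAtl.{u}}

theorem Rep.continuousAt_lift (F : Rep X Y) {i : X.I} {x : E X.dim} (hx : x ∈ (X.chart i).dom) :
    ContinuousAt (F.lift i) x :=
  (F.lift_smooth i).continuousOn.continuousAt ((X.chart i).isOpen_dom.mem_nhds hx)

/-- The local data for the composition of `F` and `G`: the change of charts `l` is the restriction
of some `k ∈ P_F`, and `w ∈ P_G` agrees with `ν_F(k)` on an open set containing the image of the
domain of `l`. -/
def Rep.CompData (F : Rep X Y) (G : Rep Y Z) (i i' : X.I) (l : PDiffeo X.dim)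
    (w : G.P (F.idx i) (F.idx i')) : Prop :=
  ∃ k : F.P i i', l.source ⊆ k.1.source ∧ EqOn l k.1 l.source ∧
    ∃ D : Set (E Y.dim), IsOpen D ∧ MapsTo (F.lift i) l.source D ∧
      D ⊆ (F.nu k).source ∩ w.1.source ∧ EqOn (F.nu k) w.1 D

theorem Rep.CompData.germ {F : Rep X Y} {G : Rep Y Z} {i i' : X.I} {l : PDiffeo X.dim}
    {w : G.P (F.idx i) (F.idx i')} (h : F.CompData G i i' l w) {x : E X.dim} (hx : x ∈ l.source) :
    ∃ k : F.P i i', x ∈ k.1.source ∧ l =ᶠ[𝓝 x] k.1 ∧ F.lift i x ∈ w.1.source ∧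
      F.nu k =ᶠ[𝓝 (F.lift i x)] w.1 := by
  obtain ⟨k, hk, hke, D, hD, hm, hs, he⟩ := h
  exact ⟨k, hk hx, hke.eventuallyEq_of_mem (l.mem_nhds hx), (hs (hm hx)).2,
    he.eventuallyEq_of_mem (hD.mem_nhds (hm hx))⟩

/-- The composition `G ∘ F` of two representatives. The set `P` consists of all changes of charts
`l` that admit some `w` as in `Rep.CompData`, and `ν(l) = ν_G(w)` for a choice of such a `w`. -/
def Rep.comp (F : Rep X Y) (G : Rep Y Z) : Rep X Z where
  base := G.base.comp F.base
  idx := G.idx ∘ F.idx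
  lift i := (X.chart i).dom.indicator (G.lift (F.idx i) ∘ F.lift i)
  lift_off i x hx := indicator_of_notMem hx _
  lift_mapsTo i x hx := by
    rw [indicator_of_mem hx]; exact G.lift_mapsTo _ (F.lift_mapsTo i hx)
  lift_smooth i := ((G.lift_smooth _).comp (F.lift_smooth i) (F.lift_mapsTo i)).congr
    fun x hx => indicator_of_mem hx _
  lift_proj i x := by
    have h1 := F.lift_proj i x
    have h2 := G.lift_proj (F.idx i) ⟨F.lift i x, F.lift_mapsTo i x.2⟩
    change _ = G.base (F.base _)
    rw [← h1, ← h2]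
    exact congrArg _ (Subtype.ext (indicator_of_mem x.2 _))
  P i i' := {l | l ∈ X.change i i' ∧ ∃ w, F.CompData G i i' l w}
  P_good := by
    refine ⟨fun i i' l hl => hl.1, fun i i' l hl x hx => ?_⟩
    obtain ⟨k, hk, hxk, e⟩ := F.P_good.germ i i' l hl x hx
    have hxd := IsChange.source_subset hl hx
    have hy : F.lift i x ∈ (F.nu ⟨k, hk⟩).source := F.nu_source ⟨k, hk⟩ hxk
    obtain ⟨w, hw, hyw, e'⟩ := G.P_good.germ _ _ _ (F.nu_mem ⟨k, hk⟩) _ hy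
    obtain ⟨D, hDs, hD, hyD⟩ := mem_nhds_iff.1 (inter_mem (inter_mem
      ((F.nu ⟨k, hk⟩).mem_nhds hy) (w.mem_nhds hyw)) e')
    obtain ⟨m, hm, hxm, hms, hme⟩ := IsChange.exists_restrict hl hx
      (inter_mem (inter_mem (k.mem_nhds hxk) e)
        ((F.continuousAt_lift hxd).preimage_mem_nhds (hD.mem_nhds hyD)))
    refine ⟨m, ⟨hm, ⟨w, hw⟩, ⟨k, hk⟩, fun y hy => (hms hy).2.1.1, fun y hy => ?_, D, hD,
      fun y hy => (hms hy).2.2, fun y hy => (hDs hy).1, fun y hy => (hDs hy).2⟩, hxm,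
      (hme.eventuallyEq_of_mem (m.mem_nhds hxm)).symm⟩
    rw [hme hy]
    exact (hms hy).2.1.2
  nu l := G.nu l.2.2.choose
  nu_mem l := G.nu_mem _
  nu_source l x hx := by
    have hxd := IsChange.source_subset l.2.1 hx
    obtain ⟨k, hxk, e, hw, e'⟩ := l.2.2.choose_spec.germ hx
    rw [indicator_of_mem hxd]
    exact G.nu_source _ hw
  nu_target {i i'} l y hy := by
    have hyd := IsChange.target_subset l.2.1 hy
    have hx := l.1.toOpenPartialHomeomorph.map_target hy
    have hyx := l.1.toOpenPartialHomeomorph.right_inv hy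
    set x := l.1.toOpenPartialHomeomorph.symm y
    obtain ⟨k, hxk, e, hw, e'⟩ := l.2.2.choose_spec.germ hx
    rw [indicator_of_mem hyd]
    refine G.nu_target _ ?_
    have h1 : F.lift i' y = l.2.2.choose.1 (F.lift i x) := by
      rw [← e'.eq_of_nhds, ← F.nu_lift k x hxk, ← e.eq_of_nhds]
      exact congrArg _ hyx.symm
    rw [h1]
    exact l.2.2.choose.1.toOpenPartialHomeomorph.map_source hw
  nu_lift l x hx := by
    have hxd := IsChange.source_subset l.2.1 hx
    obtain ⟨k, hxk, e, hw, e'⟩ := l.2.2.choose_spec.germ hx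
    rw [indicator_of_mem hxd, indicator_of_mem (IsChange.map_mem l.2.1 hx)]
    simp only [Function.comp]
    rw [← G.nu_lift _ _ hw, ← e'.eq_of_nhds, ← F.nu_lift k x hxk, ← e.eq_of_nhds]
  nu_germ l l' x hx h := by
    have hxd := IsChange.source_subset l.2.1 hx.1
    obtain ⟨k, hxk, e, hw, e'⟩ := l.2.2.choose_spec.germ hx.1
    obtain ⟨k', hxk', d, hw', d'⟩ := l'.2.2.choose_spec.germ hx.2
    rw [indicator_of_mem hxd]
    have := F.nu_germ k k' x ⟨hxk, hxk'⟩ (e.symm.trans (h.trans d))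
    exact G.nu_germ _ _ _ ⟨hw, hw'⟩ (e'.symm.trans (this.trans d'))
  nu_comp {i i' i''} l₁ l₂ l₃ x hx hx2 hx3 h := by
    have hxd := IsChange.source_subset l₁.2.1 hx
    obtain ⟨k₁, hk₁, e₁, hw₁, d₁⟩ := l₁.2.2.choose_spec.germ hx
    obtain ⟨k₂, hk₂, e₂, hw₂, d₂⟩ := l₂.2.2.choose_spec.germ hx2
    obtain ⟨k₃, hk₃, e₃, hw₃, d₃⟩ := l₃.2.2.choose_spec.germ hx3
    rw [indicator_of_mem hxd]
    have hl : l₁.1 x = k₁.1 x := e₁.eq_of_nhds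
    have hc := l₁.1.continuousAt hx
    have hk : k₃.1 =ᶠ[𝓝 x] k₂.1 ∘ k₁.1 := by
      refine e₃.symm.trans (h.trans ?_)
      filter_upwards [hc.eventually e₂, e₁] with y h1 h2
      simp only [Function.comp]
      rw [h1, h2]
    have h4 := F.nu_comp k₁ k₂ k₃ x hk₁ (hl ▸ hk₂) hk₃ hk
    have hF : F.lift i' (l₁.1 x) = (l₁.2.2.choose).1 (F.lift i x) := by
      rw [hl, F.nu_lift k₁ x hk₁, d₁.eq_of_nhds]
    rw [hF] at hw₂ d₂
    refine G.nu_comp _ _ _ _ hw₁ hw₂ hw₃ ?_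
    refine d₃.symm.trans (h4.symm.trans ?_)
    have hc' := (l₁.2.2.choose).1.continuousAt hw₁
    filter_upwards [d₁, hc'.eventually d₂] with y h1 h2
    simp only [Function.comp]
    rw [h1, h2]
  nu_id l x hx h := by
    have hxd := IsChange.source_subset l.2.1 hx
    obtain ⟨k, hxk, e, hw, e'⟩ := l.2.2.choose_spec.germ hx
    rw [indicator_of_mem hxd]
    exact G.nu_id _ _ hw (e'.symm.trans (F.nu_id k x hxk (e.symm.trans h)))

/-- The class of `G ∘ F` only depends on the classes of `F` and `G`. -/
theorem Rep.comp_equiv {F F' : Rep X Y} {G G' : Rep Y Z} (h : F.Equiv F') (h' : G.Equiv G') :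
    (F.comp G).Equiv (F'.comp G') where
  base := by
    change G.base.comp F.base = G'.base.comp F'.base
    rw [h.base, h'.base]
  idx := by
    change G.idx ∘ F.idx = G'.idx ∘ F'.idx
    rw [h.idx, h'.idx]
  lift := by
    funext i
    change (X.chart i).dom.indicator (G.lift (F.idx i) ∘ F.lift i) =
      (X.chart i).dom.indicator (G'.lift (F'.idx i) ∘ F'.lift i)
    rw [h.idx, h.lift, h'.lift]
  germ {i i'} l l' x hx e := by
    have hxd := IsChange.source_subset l.2.1 hx.1
    obtain ⟨k, hxk, e₁, hw, d₁⟩ := l.2.2.choose_spec.germ hx.1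
    obtain ⟨k', hxk', e₂, hw', d₂⟩ := l'.2.2.choose_spec.germ hx.2
    have h3 := h.germ k k' x ⟨hxk, hxk'⟩ (e₁.symm.trans (e.trans e₂))
    change G.nu l.2.2.choose =ᶠ[𝓝 ((X.chart i).dom.indicator (G.lift (F.idx i) ∘ F.lift i) x)]
      G'.nu l'.2.2.choose
    rw [indicator_of_mem hxd]
    generalize l.2.2.choose = w at *
    generalize l'.2.2.choose = w' at *
    clear l l' hx e e₁ e₂
    obtain ⟨Fb, Fi, Fl, _, _, _, _, FP, _, Fn, _, _, _, _, _, _, _⟩ := F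
    obtain ⟨Fb', Fi', Fl', _, _, _, _, FP', _, Fn', _, _, _, _, _, _, _⟩ := F'
    obtain ⟨hb, hi, hl, _⟩ := h
    dsimp only at *
    subst hi hl
    exact h'.germ w w' _ ⟨hw, hw'⟩ (d₁.symm.trans (h3.trans d₂))

/-- The composition `g ∘ f` of morphisms of reduced orbifold atlases. -/
def Mor.comp (f : Mor X Y) (g : Mor Y Z) : Mor X Z :=
  Quotient.map₂ Rep.comp (fun _ _ h _ _ h' => Rep.comp_equiv h h') f g

theorem Mor.idx_comp (f : Mor X Y) (g : Mor Y Z) (i : X.I) :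
    (f.comp g).idx i = g.idx (f.idx i) := by
  obtain ⟨F, rfl⟩ := f.exists_rep; obtain ⟨G, rfl⟩ := g.exists_rep; rfl

theorem Mor.base_comp (f : Mor X Y) (g : Mor Y Z) :
    (f.comp g).base = g.base.comp f.base := by
  obtain ⟨F, rfl⟩ := f.exists_rep; obtain ⟨G, rfl⟩ := g.exists_rep; rfl

theorem Mor.lift_comp (f : Mor X Y) (g : Mor Y Z) (i : X.I) {x : E X.dim}
    (hx : x ∈ (X.chart i).dom) : (f.comp g).lift i x = g.lift (f.idx i) (f.lift i x) := by
  obtain ⟨F, rfl⟩ := f.exists_rep; obtain ⟨G, rfl⟩ := g.exists_rep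
  exact indicator_of_mem hx _

theorem Mor.lift_mem (f : Mor X Y) {i : X.I} {x : E X.dim} (hx : x ∈ (X.chart i).dom) :
    f.lift i x ∈ (Y.chart (f.idx i)).dom := by
  obtain ⟨F, rfl⟩ := f.exists_rep; exact F.lift_mapsTo i hx

theorem Mor.continuousAt_lift (f : Mor X Y) {i : X.I} {x : E X.dim}
    (hx : x ∈ (X.chart i).dom) : ContinuousAt (f.lift i) x := by
  obtain ⟨F, rfl⟩ := f.exists_rep; exact F.continuousAt_lift hx

/-- `m` represents the germ at `f̃ᵢ(x)` that the class `[P_f, ν_f]` associates to the germ of `l`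
at `x`. -/
def Mor.Nu (f : Mor X Y) (i i' : X.I) (l : E X.dim → E X.dim) (x : E X.dim)
    (m : E Y.dim → E Y.dim) : Prop :=
  ∃ F, Mor.mk F = f ∧ ∃ k : F.P i i', x ∈ k.1.source ∧ k.1 =ᶠ[𝓝 x] l ∧
    F.nu k =ᶠ[𝓝 (f.lift i x)] m

theorem Mor.nu_exists (f : Mor X Y) {i i' : X.I} {l : PDiffeo X.dim} (hl : l ∈ X.change i i')
    {x : E X.dim} (hx : x ∈ l.source) :
    ∃ m ∈ Y.change (f.idx i) (f.idx i'), f.Nu i i' l x m ∧ f.lift i x ∈ m.source ∧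
      m (f.lift i x) = f.lift i' (l x) := by
  obtain ⟨F, rfl⟩ := f.exists_rep
  obtain ⟨k, hk, hxk, e⟩ := F.P_good.germ i i' l hl x hx
  refine ⟨F.nu ⟨k, hk⟩, F.nu_mem _, ⟨F, rfl, ⟨k, hk⟩, hxk, e.symm, EventuallyEq.rfl⟩,
    F.nu_source ⟨k, hk⟩ hxk, ?_⟩
  rw [e.eq_of_nhds]
  exact (F.nu_lift ⟨k, hk⟩ x hxk).symm

theorem Mor.nu_exists_rep (F : Rep X Y) {i i' : X.I} {l : PDiffeo X.dim} (hl : l ∈ X.change i i')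
    {x : E X.dim} (hx : x ∈ l.source) :
    ∃ k : F.P i i', x ∈ k.1.source ∧ k.1 =ᶠ[𝓝 x] l ∧ (Mor.mk F).Nu i i' l x (F.nu k) := by
  obtain ⟨k, hk, hxk, e⟩ := F.P_good.germ i i' l hl x hx
  exact ⟨⟨k, hk⟩, hxk, e.symm, F, rfl, ⟨k, hk⟩, hxk, e.symm, EventuallyEq.rfl⟩

theorem Mor.Nu.unique {f : Mor X Y} {i i' : X.I} {l l' : E X.dim → E X.dim} {x : E X.dim}
    {m m' : E Y.dim → E Y.dim} (h : f.Nu i i' l x m) (h' : f.Nu i i' l' x m')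
    (e : l =ᶠ[𝓝 x] l') : m =ᶠ[𝓝 (f.lift i x)] m' := by
  obtain ⟨F, rfl, k, hk, e₁, d₁⟩ := h
  obtain ⟨F', hF', k', hk', e₂, d₂⟩ := h'
  have := (Mor.exact hF'.symm).germ k k' x ⟨hk, hk'⟩ (e₁.trans (e.trans e₂.symm))
  exact d₁.symm.trans (EventuallyEq.trans this d₂)

theorem Mor.Nu.congr {f : Mor X Y} {i i' : X.I} {l l' : E X.dim → E X.dim} {x : E X.dim}
    {m m' : E Y.dim → E Y.dim} (h : f.Nu i i' l x m) (e : l =ᶠ[𝓝 x] l')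
    (d : m =ᶠ[𝓝 (f.lift i x)] m') : f.Nu i i' l' x m' := by
  obtain ⟨F, hF, k, hk, e₁, d₁⟩ := h
  exact ⟨F, hF, k, hk, e₁.trans e, d₁.trans d⟩

theorem Mor.Nu.comp_eq {f : Mor X Y} {i i' i'' : X.I} {l₁ l₂ l₃ : E X.dim → E X.dim}
    {x : E X.dim} {m₁ m₂ m₃ : E Y.dim → E Y.dim} (h₁ : f.Nu i i' l₁ x m₁)
    (h₂ : f.Nu i' i'' l₂ (l₁ x) m₂) (h₃ : f.Nu i i'' l₃ x m₃) (h : l₃ =ᶠ[𝓝 x] l₂ ∘ l₁) :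
    m₃ =ᶠ[𝓝 (f.lift i x)] m₂ ∘ m₁ := by
  obtain ⟨F, hF⟩ := f.exists_rep
  obtain ⟨k₁, hk₁, e₁, n₁⟩ : ∃ k : F.P i i', x ∈ k.1.source ∧ k.1 =ᶠ[𝓝 x] l₁ ∧
      f.Nu i i' l₁ x (F.nu k) := by
    obtain ⟨F', _, k, hk, e, _⟩ := h₁
    obtain ⟨k', hk', e', n⟩ := Mor.nu_exists_rep F (F'.P_good.subset _ _ k.2) hk
    rw [hF] at n
    exact ⟨k', hk', e'.trans e, n.congr e EventuallyEq.rfl⟩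
  obtain ⟨k₂, hk₂, e₂, n₂⟩ : ∃ k : F.P i' i'', l₁ x ∈ k.1.source ∧ k.1 =ᶠ[𝓝 (l₁ x)] l₂ ∧
      f.Nu i' i'' l₂ (l₁ x) (F.nu k) := by
    obtain ⟨F', _, k, hk, e, _⟩ := h₂
    obtain ⟨k', hk', e', n⟩ := Mor.nu_exists_rep F (F'.P_good.subset _ _ k.2) hk
    rw [hF] at n
    exact ⟨k', hk', e'.trans e, n.congr e EventuallyEq.rfl⟩
  obtain ⟨k₃, hk₃, e₃, n₃⟩ : ∃ k : F.P i i'', x ∈ k.1.source ∧ k.1 =ᶠ[𝓝 x] l₃ ∧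
      f.Nu i i'' l₃ x (F.nu k) := by
    obtain ⟨F', _, k, hk, e, _⟩ := h₃
    obtain ⟨k', hk', e', n⟩ := Mor.nu_exists_rep F (F'.P_good.subset _ _ k.2) hk
    rw [hF] at n
    exact ⟨k', hk', e'.trans e, n.congr e EventuallyEq.rfl⟩
  have hx1 : k₁.1 x = l₁ x := e₁.eq_of_nhds
  have hc : ContinuousAt l₁ x := (k₁.1.continuousAt hk₁).congr e₁
  have hk : k₃.1 =ᶠ[𝓝 x] k₂.1 ∘ k₁.1 := by
    filter_upwards [e₃, h, e₁, hc.eventually e₂] with y a1 a2 a3 a4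
    rw [a1, a2]
    simp only [Function.comp]
    rw [a3, a4]
  have hmain := F.nu_comp k₁ k₂ k₃ x hk₁ (hx1 ▸ hk₂) hk₃ hk
  have d₁ := h₁.unique n₁ EventuallyEq.rfl
  have d₂ := h₂.unique n₂ EventuallyEq.rfl
  have d₃ := h₃.unique n₃ EventuallyEq.rfl
  have hlf : f.lift = F.lift := by rw [← hF]; rfl
  rw [hlf] at d₁ d₂ d₃ ⊢
  have hc' : ContinuousAt m₁ (F.lift i x) :=
    ((F.nu k₁).continuousAt (F.nu_source k₁ hk₁)).congr d₁.symm
  have hy : m₁ (F.lift i x) = F.lift i' (l₁ x) := by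
    rw [d₁.eq_of_nhds, ← F.nu_lift k₁ x hk₁, hx1]
  rw [← hy] at d₂
  filter_upwards [d₃, hmain, d₁, hc'.eventually d₂] with y a1 a2 a3 a4
  rw [a1, ← a2]
  simp only [Function.comp]
  rw [a4, a3]

theorem Mor.Nu.comp {f : Mor X Y} {g : Mor Y Z} {i i' : X.I} {l : E X.dim → E X.dim}
    {x : E X.dim} {m : E Y.dim → E Y.dim} {k : E Z.dim → E Z.dim} (h : f.Nu i i' l x m)
    (h' : g.Nu (f.idx i) (f.idx i') m (f.lift i x) k) : (f.comp g).Nu i i' l x k := by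
  obtain ⟨F, rfl, a, ha, e, d⟩ := h
  obtain ⟨G, rfl, b, hb, e', d'⟩ := h'
  obtain ⟨c, hc, hxc, ec⟩ := (F.comp G).P_good.germ i i' a.1 (F.P_good.subset _ _ a.2) x ha
  refine ⟨F.comp G, rfl, ⟨c, hc⟩, hxc, ec.symm.trans e, ?_⟩
  have hxd := IsChange.source_subset (F.P_good.subset _ _ a.2) ha
  rw [Mor.lift_comp _ _ _ hxd]
  obtain ⟨a', ha', ea, hw, ew⟩ := hc.2.choose_spec.germ hxc
  have h1 := F.nu_germ a a' x ⟨ha, ha'⟩ (ec.trans ea)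
  refine EventuallyEq.trans (G.nu_germ _ b _ ⟨hw, hb⟩ ?_) d'
  exact ew.symm.trans (EventuallyEq.trans h1.symm (EventuallyEq.trans d e'.symm))

end Comp

/-! ## 2-morphisms -/

/-- A representative of a 2-morphism from `f` to `g`: for each `i`, a set of pairs consisting of an
open subset of the `i`-th chart of `X` and of a change of charts of `Y`. -/
structure TwoRep {X Y : RedAtl.{u}} (f g : Mor X Y) where
  base_eq : f.base = g.base
  pieces : X.I → Set (Set (E X.dim) × PDiffeo Y.dim)
  isOpen : ∀ i, ∀ p ∈ pieces i, IsOpen p.1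
  cover : ∀ i, ⋃ p ∈ pieces i, p.1 = (X.chart i).dom
  mem_change : ∀ i, ∀ p ∈ pieces i, p.2 ∈ Y.change (f.idx i) (g.idx i)
  source : ∀ i, ∀ p ∈ pieces i, MapsTo (f.lift i) p.1 p.2.source
  target : ∀ i, ∀ p ∈ pieces i, MapsTo (g.lift i) p.1 p.2.target
  lift_eq : ∀ i, ∀ p ∈ pieces i, ∀ x ∈ p.1, g.lift i x = p.2 (f.lift i x)
  germ_eq : ∀ i, ∀ p ∈ pieces i, ∀ p' ∈ pieces i, ∀ x ∈ p.1 ∩ p'.1,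
    p.2 =ᶠ[𝓝 (f.lift i x)] p'.2
  /-- `germ ν_g(l₂) · germ δᵢ = germ δᵢ' · germ ν_f(l₁)` whenever `l₁`, `l₂` and `l` have the same
  germ at `x` -/
  comm : ∀ i i', ∀ p ∈ pieces i, ∀ p' ∈ pieces i', ∀ l ∈ X.change i i',
    ∀ x ∈ l.source ∩ p.1, l x ∈ p'.1 →
    ∃ F₁ F₂ : Rep X Y, Mor.mk F₁ = f ∧ Mor.mk F₂ = g ∧
      ∃ (l₁ : F₁.P i i') (l₂ : F₂.P i i'),
        x ∈ l₁.1.source ∧ x ∈ l₂.1.source ∧ l₁.1 =ᶠ[𝓝 x] l ∧ l₂.1 =ᶠ[𝓝 x] l ∧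
        F₂.nu l₂ ∘ p.2 =ᶠ[𝓝 (f.lift i x)] p'.2 ∘ F₁.nu l₁

section Two

variable {X Y Z : RedAtl.{u}}

theorem TwoRep.subset {f g : Mor X Y} (δ : TwoRep f g) {i : X.I}
    {p : Set (E X.dim) × PDiffeo Y.dim} (hp : p ∈ δ.pieces i) : p.1 ⊆ (X.chart i).dom := by
  rw [← δ.cover i]; exact subset_biUnion_of_mem (u := fun p => p.1) hp

theorem TwoRep.exists_piece {f g : Mor X Y} (δ : TwoRep f g) {i : X.I} {x : E X.dim}
    (hx : x ∈ (X.chart i).dom) : ∃ p ∈ δ.pieces i, x ∈ p.1 := by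
  rw [← δ.cover i] at hx; simpa using hx

/-- Equivalence of representatives of 2-morphisms. -/
def TwoRep.Equiv {f g : Mor X Y} (δ δ' : TwoRep f g) : Prop :=
  ∀ i, ∀ p ∈ δ.pieces i, ∀ p' ∈ δ'.pieces i, ∀ x ∈ p.1 ∩ p'.1, p.2 =ᶠ[𝓝 (f.lift i x)] p'.2

instance TwoRep.setoid (f g : Mor X Y) : Setoid (TwoRep f g) where
  r := TwoRep.Equiv
  iseqv :=
    { refl δ := δ.germ_eq
      symm h i p hp p' hp' x hx := (h i p' hp' p hp x hx.symm).symm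
      trans {δ δ' δ''} h h' i p hp p' hp' x hx := by
        obtain ⟨q, hq, hxq⟩ := δ'.exists_piece (δ.subset hp hx.1)
        exact (h i p hp q hq x ⟨hx.1, hxq⟩).trans (h' i q hq p' hp' x ⟨hxq, hx.2⟩) }

/-- 2-morphisms: equivalence classes of representatives. -/
def TwoMor (f g : Mor X Y) : Type u := Quotient (TwoRep.setoid f g)

theorem TwoRep.comm' {f g : Mor X Y} (δ : TwoRep f g) {i i' : X.I}
    {p : Set (E X.dim) × PDiffeo Y.dim} (hp : p ∈ δ.pieces i)
    {p' : Set (E X.dim) × PDiffeo Y.dim} (hp' : p' ∈ δ.pieces i')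
    {l : PDiffeo X.dim} (hl : l ∈ X.change i i') {x : E X.dim} (hx : x ∈ l.source)
    (hxp : x ∈ p.1) (hxp' : l x ∈ p'.1) {m₁ m₂ : E Y.dim → E Y.dim} (h₁ : f.Nu i i' l x m₁)
    (h₂ : g.Nu i i' l x m₂) : m₂ ∘ p.2 =ᶠ[𝓝 (f.lift i x)] p'.2 ∘ m₁ := by
  obtain ⟨F₁, F₂, hF₁, hF₂, l₁, l₂, hx₁, hx₂, e₁, e₂, h⟩ :=
    δ.comm i i' p hp p' hp' l hl x ⟨hx, hxp⟩ hxp'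
  have d₁ := h₁.unique ⟨F₁, hF₁, l₁, hx₁, e₁, EventuallyEq.rfl⟩ EventuallyEq.rfl
  have d₂ := h₂.unique ⟨F₂, hF₂, l₂, hx₂, e₂, EventuallyEq.rfl⟩ EventuallyEq.rfl
  have hc := p.2.continuousAt (δ.source i p hp hxp)
  rw [δ.lift_eq i p hp x hxp] at d₂
  filter_upwards [d₁, hc.eventually d₂, h] with y a1 a2 a3
  simp only [Function.comp] at a3 ⊢
  rw [a2, a3, a1]

/-- It is enough to check the compatibility with changes of charts on the germs associated to
the classes `[P_f, ν_f]` and `[P_g, ν_g]`. -/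
theorem comm_of_nu {f g : Mor X Y} {i i' : X.I} {a b : E Y.dim → E Y.dim} {l : PDiffeo X.dim}
    (hl : l ∈ X.change i i') {x : E X.dim} (hx : x ∈ l.source)
    (h : ∀ m₁ m₂ : PDiffeo Y.dim, f.Nu i i' l x m₁ → g.Nu i i' l x m₂ →
      m₂ ∘ a =ᶠ[𝓝 (f.lift i x)] b ∘ m₁) :
    ∃ F₁ F₂ : Rep X Y, Mor.mk F₁ = f ∧ Mor.mk F₂ = g ∧
      ∃ (l₁ : F₁.P i i') (l₂ : F₂.P i i'),
        x ∈ l₁.1.source ∧ x ∈ l₂.1.source ∧ l₁.1 =ᶠ[𝓝 x] l ∧ l₂.1 =ᶠ[𝓝 x] l ∧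
        F₂.nu l₂ ∘ a =ᶠ[𝓝 (f.lift i x)] b ∘ F₁.nu l₁ := by
  obtain ⟨F, rfl⟩ := f.exists_rep
  obtain ⟨G, rfl⟩ := g.exists_rep
  obtain ⟨k, hk, e, n⟩ := Mor.nu_exists_rep F hl hx
  obtain ⟨k', hk', e', n'⟩ := Mor.nu_exists_rep G hl hx
  exact ⟨F, G, rfl, rfl, k, k', hk, hk', e, e', h _ _ n n'⟩

/-- The representative `{(X̃ᵢ, id)}` of the 2-identity of `f`. -/
def TwoRep.id (f : Mor X Y) : TwoRep f f where
  base_eq := rfl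
  pieces i := {((X.chart i).dom,
    PDiffeo.idOn (Y.chart (f.idx i)).dom (Y.chart (f.idx i)).isOpen_dom)}
  isOpen := by rintro i _ rfl; exact (X.chart i).isOpen_dom
  cover i := by simp
  mem_change := by rintro i _ rfl; exact isChange_idOn _
  source := by rintro i _ rfl x hx; exact f.lift_mem hx
  target := by rintro i _ rfl x hx; exact f.lift_mem hx
  lift_eq := by rintro i _ rfl x hx; exact (PDiffeo.idOn_apply _ _ _).symm
  germ_eq := by rintro i _ rfl _ rfl x hx; rfl
  comm := by
    rintro i i' _ rfl _ rfl l hl x hx -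
    refine comm_of_nu hl hx.1 fun m₁ m₂ h₁ h₂ => ?_
    filter_upwards [h₁.unique h₂ EventuallyEq.rfl] with y hy
    simp only [Function.comp, PDiffeo.idOn_apply]
    exact hy.symm

/-- The 2-identity of `f`. -/
def TwoMor.id (f : Mor X Y) : TwoMor f f := Quotient.mk _ (TwoRep.id f)

/-- `(W, θ)` is a piece of the vertical composition of `δ` and `σ`: for some pieces `a` of `δ` and
`b` of `σ`, the set `W` is contained in both their open sets and `θ` is a restriction of `b ∘ a`. -/
structure TwoRep.VPiece {f g h : Mor X Y} (δ : TwoRep f g) (σ : TwoRep g h) (i : X.I)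
    (p a b : Set (E X.dim) × PDiffeo Y.dim) : Prop where
  left : a ∈ δ.pieces i
  right : b ∈ σ.pieces i
  isOpen : IsOpen p.1
  subset : p.1 ⊆ a.1 ∩ b.1
  mem_change : p.2 ∈ Y.change (f.idx i) (h.idx i)
  source : MapsTo (f.lift i) p.1 p.2.source
  source_subset : ∀ y ∈ p.2.source, y ∈ a.2.source ∧ a.2 y ∈ b.2.source
  eqOn : EqOn p.2 (b.2 ∘ a.2) p.2.source

theorem TwoRep.VPiece.germ {f g h : Mor X Y} {δ : TwoRep f g} {σ : TwoRep g h} {i : X.I}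
    {p a b : Set (E X.dim) × PDiffeo Y.dim} (H : δ.VPiece σ i p a b) {x : E X.dim}
    (hx : x ∈ p.1) : p.2 =ᶠ[𝓝 (f.lift i x)] b.2 ∘ a.2 :=
  H.eqOn.eventuallyEq_of_mem (p.2.mem_nhds (H.source hx))

theorem TwoRep.VPiece.lift_eq {f g h : Mor X Y} {δ : TwoRep f g} {σ : TwoRep g h} {i : X.I}
    {p a b : Set (E X.dim) × PDiffeo Y.dim} (H : δ.VPiece σ i p a b) {x : E X.dim}
    (hx : x ∈ p.1) : h.lift i x = p.2 (f.lift i x) := by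
  rw [H.eqOn (H.source hx), σ.lift_eq i b H.right x (H.subset hx).2,
    δ.lift_eq i a H.left x (H.subset hx).1]; rfl

/-- If `a`, `a'` are equal germs, and `b`, `b'` are equal germs at the image point, then the
compositions are equal germs. -/
theorem germ_comp_congr {α β γ : Type*} [TopologicalSpace α] [TopologicalSpace β]
    {a a' : α → β} {b b' : β → γ} {x : α} {y : β} (ha : ContinuousAt a x) (hy : a x = y)
    (e : a =ᶠ[𝓝 x] a') (e' : b =ᶠ[𝓝 y] b') : b ∘ a =ᶠ[𝓝 x] b' ∘ a' := by
  subst hy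
  filter_upwards [e, ha.eventually e'] with z h1 h2
  simp only [Function.comp]
  rw [h2, h1]

/-- The vertical composition `σ ⊙ δ` of representatives. -/
def TwoRep.vcomp {f g h : Mor X Y} (δ : TwoRep f g) (σ : TwoRep g h) : TwoRep f h where
  base_eq := δ.base_eq.trans σ.base_eq
  pieces i := {p | ∃ a b, δ.VPiece σ i p a b}
  isOpen := by rintro i p ⟨a, b, H⟩; exact H.isOpen
  cover i := by
    refine Subset.antisymm (iUnion₂_subset ?_) fun x hx => ?_
    · rintro p ⟨a, b, H⟩ x hx
      exact δ.subset H.left (H.subset hx).1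
    · obtain ⟨a, ha, hxa⟩ := δ.exists_piece hx
      obtain ⟨b, hb, hxb⟩ := σ.exists_piece hx
      have hy := δ.source i a ha hxa
      have hy' : a.2 (f.lift i x) ∈ b.2.source := by
        rw [← δ.lift_eq i a ha x hxa]; exact σ.source i b hb hxb
      obtain ⟨k, hk, hyk, hks, hke⟩ := IsChange.exists_comp (δ.mem_change i a ha)
        (σ.mem_change i b hb) hy hy' univ_mem
      obtain ⟨W, hW, hWo, hxW⟩ := mem_nhds_iff.1 (inter_mem (inter_mem
        ((δ.isOpen i a ha).mem_nhds hxa) ((σ.isOpen i b hb).mem_nhds hxb))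
        ((f.continuousAt_lift hx).preimage_mem_nhds (k.mem_nhds hyk)))
      simp only [mem_iUnion]
      exact ⟨(W, k), ⟨a, b, ha, hb, hWo, fun y hy => (hW hy).1, hk, fun y hy => (hW hy).2,
        fun y hy => ⟨(hks hy).1, (hks hy).2.1⟩, hke⟩, hxW⟩
  mem_change := by rintro i p ⟨a, b, H⟩; exact H.mem_change
  source := by rintro i p ⟨a, b, H⟩; exact H.source
  target := by
    rintro i p ⟨a, b, H⟩ x hx
    rw [H.lift_eq hx]
    exact p.2.toOpenPartialHomeomorph.map_source (H.source hx)
  lift_eq := by rintro i p ⟨a, b, H⟩ x hx; exact H.lift_eq hx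
  germ_eq := by
    rintro i p ⟨a, b, H⟩ p' ⟨a', b', H'⟩ x hx
    have h1 := H.subset hx.1
    have h2 := H'.subset hx.2
    refine (H.germ hx.1).trans (EventuallyEq.trans ?_ (H'.germ hx.2).symm)
    exact germ_comp_congr (a.2.continuousAt (δ.source i a H.left h1.1))
      (δ.lift_eq i a H.left x h1.1).symm (δ.germ_eq i a H.left a' H'.left x ⟨h1.1, h2.1⟩)
      (σ.germ_eq i b H.right b' H'.right x ⟨h1.2, h2.2⟩)
  comm := by
    rintro i i' p ⟨a, b, H⟩ p' ⟨a', b', H'⟩ l hl x hx hx'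
    have h1 := H.subset hx.2
    have h2 := H'.subset hx'
    refine comm_of_nu hl hx.1 fun m₁ m₃ n₁ n₃ => ?_
    obtain ⟨m₂, hm₂, n₂, hs₂, hv₂⟩ := g.nu_exists hl hx.1
    obtain ⟨q₁, hq₁, r₁, hs₁, hv₁⟩ := f.nu_exists hl hx.1
    have c1 := δ.comm' H.left H'.left hl hx.1 h1.1 h2.1 n₁ n₂
    have c2 := σ.comm' H.right H'.right hl hx.1 h1.2 h2.2 n₂ n₃
    have d := r₁.unique n₁ EventuallyEq.rfl
    have hca := a.2.continuousAt (δ.source i a H.left h1.1)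
    have hya := (δ.lift_eq i a H.left x h1.1).symm
    have hcm : ContinuousAt m₁ (f.lift i x) := (q₁.continuousAt hs₁).congr d
    have hvm : m₁ (f.lift i x) = f.lift i' (l x) := by rw [← d.eq_of_nhds, hv₁]
    have e1 := germ_comp_congr hca hya (EventuallyEq.rfl (f := a.2)) c2
    have e2 := H.germ hx.2
    have e3 := germ_comp_congr hcm hvm (EventuallyEq.rfl (f := m₁)) (H'.germ hx')
    filter_upwards [c1, e1, e2, e3] with y a1 a2 a3 a4
    simp only [Function.comp] at *
    rw [a3, a2, a1, a4]

theorem TwoRep.vcomp_equiv {f g h : Mor X Y} {δ δ' : TwoRep f g} {σ σ' : TwoRep g h}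
    (hδ : δ.Equiv δ') (hσ : σ.Equiv σ') : (δ.vcomp σ).Equiv (δ'.vcomp σ') := by
  rintro i p ⟨a, b, H⟩ p' ⟨a', b', H'⟩ x hx
  have h1 := H.subset hx.1
  have h2 := H'.subset hx.2
  refine (H.germ hx.1).trans (EventuallyEq.trans ?_ (H'.germ hx.2).symm)
  exact germ_comp_congr (a.2.continuousAt (δ.source i a H.left h1.1))
    (δ.lift_eq i a H.left x h1.1).symm (hδ i a H.left a' H'.left x ⟨h1.1, h2.1⟩)
    (hσ i b H.right b' H'.right x ⟨h1.2, h2.2⟩)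

/-- The vertical composition `[σ] ⊙ [δ]` of 2-morphisms. -/
def TwoMor.vcomp {f g h : Mor X Y} (δ : TwoMor f g) (σ : TwoMor g h) : TwoMor f h :=
  Quotient.map₂ TwoRep.vcomp (fun _ _ h _ _ h' => TwoRep.vcomp_equiv h h') δ σ

/-- `(W, γ)` is a piece of the horizontal composition of `δ` and `ξ`: for some piece `a` of `δ`,
some representative `(P, ν)` of the class of `g₁`, some `d ∈ P` that agrees with `a.2` on an open
set `D` containing the image of `W`, and some piece `c` of `ξ`, the change of charts `γ` is a
restriction of `c ∘ ν(d)`. -/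
structure TwoRep.HPiece {f₁ f₂ : Mor X Y} {g₁ g₂ : Mor Y Z} (δ : TwoRep f₁ f₂) (ξ : TwoRep g₁ g₂)
    (i : X.I) (p : Set (E X.dim) × PDiffeo Z.dim) (a : Set (E X.dim) × PDiffeo Y.dim)
    (c : Set (E Y.dim) × PDiffeo Z.dim) (G : Rep Y Z) (d : G.P (f₁.idx i) (f₂.idx i))
    (D : Set (E Y.dim)) : Prop where
  rep : Mor.mk G = g₁
  left : a ∈ δ.pieces i
  right : c ∈ ξ.pieces (f₂.idx i)
  isOpen : IsOpen p.1
  subset : p.1 ⊆ a.1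
  mapsTo : MapsTo (f₂.lift i) p.1 c.1
  isOpen_D : IsOpen D
  mapsTo_D : MapsTo (f₁.lift i) p.1 D
  D_subset : D ⊆ a.2.source ∩ d.1.source
  eqOn_D : EqOn a.2 d.1 D
  mem_change : p.2 ∈ Z.change ((f₁.comp g₁).idx i) ((f₂.comp g₂).idx i)
  source : MapsTo ((f₁.comp g₁).lift i) p.1 p.2.source
  source_subset : ∀ z ∈ p.2.source, z ∈ (G.nu d).source ∧ G.nu d z ∈ c.2.source
  eqOn : EqOn p.2 (c.2 ∘ G.nu d) p.2.source

/-- The germ of a piece of the horizontal composition. -/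
theorem TwoRep.HPiece.germ {f₁ f₂ : Mor X Y} {g₁ g₂ : Mor Y Z} {δ : TwoRep f₁ f₂}
    {ξ : TwoRep g₁ g₂} {i : X.I} {p : Set (E X.dim) × PDiffeo Z.dim}
    {a : Set (E X.dim) × PDiffeo Y.dim} {c : Set (E Y.dim) × PDiffeo Z.dim} {G : Rep Y Z}
    {d : G.P (f₁.idx i) (f₂.idx i)} {D : Set (E Y.dim)} (H : δ.HPiece ξ i p a c G d D)
    {x : E X.dim} (hx : x ∈ p.1) :
    x ∈ (X.chart i).dom ∧ f₁.lift i x ∈ a.2.source ∧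
    g₁.Nu (f₁.idx i) (f₂.idx i) a.2 (f₁.lift i x) (G.nu d) ∧
    ContinuousAt (G.nu d) ((f₁.comp g₁).lift i x) ∧
    G.nu d ((f₁.comp g₁).lift i x) = g₁.lift (f₂.idx i) (f₂.lift i x) ∧
    p.2 =ᶠ[𝓝 ((f₁.comp g₁).lift i x)] c.2 ∘ G.nu d := by
  have hxd := δ.subset H.left (H.subset hx)
  have hD := H.D_subset (H.mapsTo_D hx)
  have he := H.eqOn_D.eventuallyEq_of_mem (H.isOpen_D.mem_nhds (H.mapsTo_D hx))
  refine ⟨hxd, hD.1, ⟨G, H.rep, d, hD.2, he.symm, EventuallyEq.rfl⟩,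
    (G.nu d).continuousAt (H.source_subset _ (H.source hx)).1, ?_,
    H.eqOn.eventuallyEq_of_mem (p.2.mem_nhds (H.source hx))⟩
  rw [Mor.lift_comp _ _ _ hxd]
  have hl : g₁.lift = G.lift := by rw [← H.rep]; rfl
  rw [hl, ← G.nu_lift d _ hD.2, ← he.eq_of_nhds, δ.lift_eq i a H.left x (H.subset hx)]

theorem TwoRep.HPiece.lift_eq {f₁ f₂ : Mor X Y} {g₁ g₂ : Mor Y Z} {δ : TwoRep f₁ f₂}
    {ξ : TwoRep g₁ g₂} {i : X.I} {p : Set (E X.dim) × PDiffeo Z.dim}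
    {a : Set (E X.dim) × PDiffeo Y.dim} {c : Set (E Y.dim) × PDiffeo Z.dim} {G : Rep Y Z}
    {d : G.P (f₁.idx i) (f₂.idx i)} {D : Set (E Y.dim)} (H : δ.HPiece ξ i p a c G d D)
    {x : E X.dim} (hx : x ∈ p.1) :
    (f₂.comp g₂).lift i x = p.2 ((f₁.comp g₁).lift i x) := by
  obtain ⟨hxd, _, _, _, hv, he⟩ := H.germ hx
  rw [he.eq_of_nhds, Function.comp, hv, Mor.lift_comp _ _ _ hxd]
  exact ξ.lift_eq _ c H.right _ (H.mapsTo hx)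

theorem TwoRep.HPiece.germ_congr {f₁ f₂ : Mor X Y} {g₁ g₂ : Mor Y Z} {δ δ' : TwoRep f₁ f₂}
    {ξ ξ' : TwoRep g₁ g₂} (hδ : δ.Equiv δ') (hξ : ξ.Equiv ξ') {i : X.I}
    {p p' : Set (E X.dim) × PDiffeo Z.dim}
    {a a' : Set (E X.dim) × PDiffeo Y.dim} {c c' : Set (E Y.dim) × PDiffeo Z.dim} {G G' : Rep Y Z}
    {d : G.P (f₁.idx i) (f₂.idx i)} {D : Set (E Y.dim)} (H : δ.HPiece ξ i p a c G d D)
    {d' : G'.P (f₁.idx i) (f₂.idx i)} {D' : Set (E Y.dim)} (H' : δ'.HPiece ξ' i p' a' c' G' d' D')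
    {x : E X.dim} (hx : x ∈ p.1) (hx' : x ∈ p'.1) :
    p.2 =ᶠ[𝓝 ((f₁.comp g₁).lift i x)] p'.2 := by
  obtain ⟨hxd, _, n, hc, hv, he⟩ := H.germ hx
  obtain ⟨_, _, n', hc', hv', he'⟩ := H'.germ hx'
  have ea := hδ i a H.left a' H'.left x ⟨H.subset hx, H'.subset hx'⟩
  have ec := hξ _ c H.right c' H'.right _ ⟨H.mapsTo hx, H'.mapsTo hx'⟩
  have en := n.unique n' ea
  rw [← Mor.lift_comp _ _ _ hxd] at en
  exact he.trans ((germ_comp_congr hc hv en ec).trans he'.symm)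

/-- The horizontal composition `ξ ∗ δ` of representatives. -/
def TwoRep.hcomp {f₁ f₂ : Mor X Y} {g₁ g₂ : Mor Y Z} (δ : TwoRep f₁ f₂) (ξ : TwoRep g₁ g₂) :
    TwoRep (f₁.comp g₁) (f₂.comp g₂) where
  base_eq := by rw [Mor.base_comp, Mor.base_comp, δ.base_eq, ξ.base_eq]
  pieces i := {p | ∃ a c G d D, δ.HPiece ξ i p a c G d D}
  isOpen := by rintro i p ⟨a, c, G, d, D, H⟩; exact H.isOpen
  cover i := by
    refine Subset.antisymm (iUnion₂_subset ?_) fun x hx => ?_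
    · rintro p ⟨a, c, G, d, D, H⟩ x hx
      exact δ.subset H.left (H.subset hx)
    · obtain ⟨a, ha, hxa⟩ := δ.exists_piece hx
      obtain ⟨c, hc, hxc⟩ := ξ.exists_piece (f₂.lift_mem hx)
      obtain ⟨G, hG⟩ := g₁.exists_rep
      have hy := δ.source i a ha hxa
      obtain ⟨d, hd, hyd, e⟩ := G.P_good.germ _ _ a.2 (δ.mem_change i a ha) _ hy
      obtain ⟨D, hDs, hD, hyD⟩ := mem_nhds_iff.1 (inter_mem (inter_mem
        (a.2.mem_nhds hy) (d.mem_nhds hyd)) e)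
      have hl : g₁.lift = G.lift := by rw [← hG]; rfl
      have hidx : g₁.idx = G.idx := by rw [← hG]; rfl
      have hlc := Mor.lift_comp f₁ g₁ i hx
      have hz : (f₁.comp g₁).lift i x ∈ (G.nu ⟨d, hd⟩).source := by
        rw [hlc, hl]; exact G.nu_source ⟨d, hd⟩ hyd
      have hz' : G.nu ⟨d, hd⟩ ((f₁.comp g₁).lift i x) ∈ c.2.source := by
        rw [hlc, hl, ← G.nu_lift ⟨d, hd⟩ _ hyd]
        change G.lift _ (d _) ∈ _
        rw [← e.eq_of_nhds, ← δ.lift_eq i a ha x hxa, ← hl]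
        exact ξ.source _ c hc hxc
      have hch : G.nu ⟨d, hd⟩ ∈ Z.change (g₁.idx (f₁.idx i)) (g₁.idx (f₂.idx i)) := by
        rw [hidx]; exact G.nu_mem ⟨d, hd⟩
      obtain ⟨k, hk, hzk, hks, hke⟩ := IsChange.exists_comp hch (ξ.mem_change _ c hc) hz hz'
        univ_mem
      obtain ⟨W, hW, hWo, hxW⟩ := mem_nhds_iff.1 (inter_mem (inter_mem
        ((δ.isOpen i a ha).mem_nhds hxa)
        ((f₂.continuousAt_lift hx).preimage_mem_nhds ((ξ.isOpen _ c hc).mem_nhds hxc)))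
        (inter_mem ((f₁.continuousAt_lift hx).preimage_mem_nhds (hD.mem_nhds hyD))
          (((f₁.comp g₁).continuousAt_lift hx).preimage_mem_nhds (k.mem_nhds hzk))))
      simp only [mem_iUnion]
      exact ⟨(W, k), ⟨a, c, G, ⟨d, hd⟩, D, hG, ha, hc, hWo, fun y hy => (hW hy).1.1,
        fun y hy => (hW hy).1.2, hD, fun y hy => (hW hy).2.1, fun y hy => (hDs hy).1,
        fun y hy => (hDs hy).2, by rw [Mor.idx_comp, Mor.idx_comp]; exact hk,
        fun y hy => (hW hy).2.2, fun y hy => ⟨(hks hy).1, (hks hy).2.1⟩, hke⟩, hxW⟩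
  mem_change := by rintro i p ⟨a, c, G, d, D, H⟩; exact H.mem_change
  source := by rintro i p ⟨a, c, G, d, D, H⟩; exact H.source
  target := by
    rintro i p ⟨a, c, G, d, D, H⟩ x hx
    rw [H.lift_eq hx]
    exact p.2.toOpenPartialHomeomorph.map_source (H.source hx)
  lift_eq := by rintro i p ⟨a, c, G, d, D, H⟩ x hx; exact H.lift_eq hx
  germ_eq := by
    rintro i p ⟨a, c, G, d, D, H⟩ p' ⟨a', c', G', d', D', H'⟩ x hx
    exact H.germ_congr δ.germ_eq ξ.germ_eq H' hx.1 hx.2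
  comm := by
    rintro i i' p ⟨a, c, G, d, D, H⟩ p' ⟨a', c', G', d', D', H'⟩ l hl x hx hx'
    refine comm_of_nu hl hx.1 fun k₁ k₂ n₁ n₂ => ?_
    obtain ⟨hxd, hya, na, hc, hv, he⟩ := H.germ hx.2
    obtain ⟨hxd', hya', na', hc', hv', he'⟩ := H'.germ hx'
    obtain ⟨m₁, hm₁, r₁, hs₁, hv₁⟩ := f₁.nu_exists hl hx.1
    obtain ⟨m₂, hm₂, r₂, hs₂, hv₂⟩ := f₂.nu_exists hl hx.1
    obtain ⟨q₁, hq₁, t₁, hw₁, hz₁⟩ := g₁.nu_exists hm₁ hs₁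
    obtain ⟨q₂, hq₂, t₂, hw₂, hz₂⟩ := g₂.nu_exists hm₂ hs₂
    obtain ⟨q₃, hq₃, t₃, hw₃, hz₃⟩ := g₁.nu_exists hm₂ hs₂
    have u₁ := n₁.unique (r₁.comp t₁) EventuallyEq.rfl
    have u₂ := n₂.unique (r₂.comp t₂) EventuallyEq.rfl
    have cδ := δ.comm' H.left H'.left hl hx.1 (H.subset hx.2) (H'.subset hx') r₁ r₂
    have cξ := ξ.comm' H.right H'.right hm₂ hs₂ (H.mapsTo hx.2)
      (by rw [hv₂]; exact H'.mapsTo hx') t₃ t₂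
    have hay : a.2 (f₁.lift i x) = f₂.lift i x :=
      (δ.lift_eq i a H.left x (H.subset hx.2)).symm
    -- a change of charts representing the germ of `m₂ ∘ a = a' ∘ m₁`
    obtain ⟨b, hb, hyb, hbs, hbe⟩ := IsChange.exists_comp (δ.mem_change i a H.left) hm₂ hya
      (by rw [hay]; exact hs₂) univ_mem
    have hbe' : b =ᶠ[𝓝 (f₁.lift i x)] m₂ ∘ a.2 := hbe.eventuallyEq_of_mem (b.mem_nhds hyb)
    obtain ⟨q, hq, t, _, _⟩ := g₁.nu_exists hb hyb
    have w₁ := Mor.Nu.comp_eq na (by rw [hay]; exact t₃) t hbe'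
    have w₂ := Mor.Nu.comp_eq t₁ (by rw [hv₁]; exact na') t (hbe'.trans cδ)
    have hlc := Mor.lift_comp f₁ g₁ i hxd
    rw [← hlc] at w₁ w₂ hz₁ hw₁
    have hlc' := Mor.lift_comp f₁ g₁ i' hxd'
    rw [hv₁, ← hlc'] at hz₁
    have hlc2 := Mor.lift_comp f₂ g₂ i hxd
    -- `k₂ ∘ p = q₂ ∘ c ∘ ν(d) = c' ∘ q₃ ∘ ν(d) = c' ∘ ν(d') ∘ q₁ = p' ∘ k₁`
    have s1 : k₂ ∘ p.2 =ᶠ[𝓝 ((f₁.comp g₁).lift i x)] q₂ ∘ (c.2 ∘ G.nu d) :=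
      germ_comp_congr (p.2.continuousAt (H.source hx.2)) (H.lift_eq hx.2).symm he u₂
    have s2 : (q₂ ∘ c.2) ∘ G.nu d =ᶠ[𝓝 ((f₁.comp g₁).lift i x)] (c'.2 ∘ q₃) ∘ G.nu d :=
      germ_comp_congr hc hv EventuallyEq.rfl cξ
    have s3 : p'.2 ∘ k₁ =ᶠ[𝓝 ((f₁.comp g₁).lift i x)] (c'.2 ∘ G'.nu d') ∘ q₁ :=
      (germ_comp_congr (q₁.continuousAt hw₁) hz₁ u₁.symm he'.symm).symm
    filter_upwards [s1, s2, s3, w₁, w₂] with z a1 a2 a3 a4 a5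
    simp only [Function.comp] at *
    rw [a1, a2, a3, ← a4, a5]

theorem TwoRep.hcomp_equiv {f₁ f₂ : Mor X Y} {g₁ g₂ : Mor Y Z} {δ δ' : TwoRep f₁ f₂}
    {ξ ξ' : TwoRep g₁ g₂} (hδ : δ.Equiv δ') (hξ : ξ.Equiv ξ') :
    (δ.hcomp ξ).Equiv (δ'.hcomp ξ') := by
  rintro i p ⟨a, c, G, d, D, H⟩ p' ⟨a', c', G', d', D', H'⟩ x hx
  exact H.germ_congr hδ hξ H' hx.1 hx.2

/-- The horizontal composition `[ξ] ∗ [δ]` of 2-morphisms. -/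
def TwoMor.hcomp {f₁ f₂ : Mor X Y} {g₁ g₂ : Mor Y Z} (δ : TwoMor f₁ f₂) (ξ : TwoMor g₁ g₂) :
    TwoMor (f₁.comp g₁) (f₂.comp g₂) :=
  Quotient.map₂ TwoRep.hcomp (fun _ _ h _ _ h' => TwoRep.hcomp_equiv h h') δ ξ

end Two

end Orbifold

end

open CategoryTheory Bicategory Orbifold

universe u

/-!
The proof works with germs instead of representatives. A morphism `f` is determined by its
underlying data and by the relation `Mor.Nu`, the functorial assignment of germs of changes of
charts of `Y` to germs of changes of charts of `X` (`Mor.ext`). In the same way, a 2-morphism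
`δ : f ⇒ g` is determined by its germs at the points `f̃ᵢ(x)` (`TwoMor.Germ`, `TwoMor.ext`). Germs
of the compositions are given by simple formulas: the germ of `σ ⊙ δ` at `x` is the composition of
the germs of `σ` and `δ` at `x` (`TwoMor.Germ.vcomp`), and the germ of `ξ ∗ δ` at `x` is the germ of
`ξ` at `f̃²ᵢ(x)` after the germ that `g¹` associates to the germ of `δ` at `x`
(`TwoMor.Germ.hcomp`).

All laws then become identities between compositions of germs. Those that do not mix the two
directions follow from associativity of the composition of germs and from functoriality of
`Mor.Nu`. The interchange law (`TwoMor.interchange`) needs in addition that `ξ : g¹ ⇒ g²` commutes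
with the germs of changes of charts, applied to the germ of the 2-morphism `σ` in `Y`; this is
`TwoMor.Germ.naturality`. Composition of morphisms is strictly associative and unital, so the
associators and unitors are the 2-morphisms given by equalities of morphisms; all their germs are
germs of the identity, which gives the coherence conditions.
-/

namespace Orbifold

variable {X Y Z T : RedAtl.{u}}

/-! ### The action of a morphism on germs of changes of charts -/

/-- A morphism is determined by its underlying data and by the germs it associates to germs of
changes of charts. -/
theorem Mor.ext {f g : Mor X Y} (hb : f.base = g.base) (hi : f.idx = g.idx)
    (hl : f.lift = g.lift)
    (h : ∀ i i', ∀ l ∈ X.change i i', ∀ x ∈ l.source, ∃ m, f.Nu i i' l x m ∧ g.Nu i i' l x m) :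
    f = g := by
  obtain ⟨F, rfl⟩ := f.exists_rep
  obtain ⟨G, rfl⟩ := g.exists_rep
  refine Mor.sound ⟨hb, hi, hl, fun {i i'} l l' x hx e => ?_⟩
  obtain ⟨m, n₁, n₂⟩ := h i i' l.1 (F.P_good.subset _ _ l.2) x hx.1
  have d₁ : F.nu l =ᶠ[𝓝 (F.lift i x)] m :=
    Mor.Nu.unique (f := Mor.mk F) ⟨F, rfl, l, hx.1, EventuallyEq.rfl, EventuallyEq.rfl⟩ n₁
      EventuallyEq.rfl
  have d₂ : m =ᶠ[𝓝 (G.lift i x)] G.nu l' :=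
    Mor.Nu.unique (f := Mor.mk G) n₂ ⟨G, rfl, l', hx.2, e.symm, EventuallyEq.rfl⟩
      EventuallyEq.rfl
  have hl' : F.lift = G.lift := hl
  rw [← hl'] at d₂
  exact d₁.trans d₂

theorem Mor.lift_of_notMem (f : Mor X Y) {i : X.I} {x : E X.dim} (hx : x ∉ (X.chart i).dom) :
    f.lift i x = 0 := by
  obtain ⟨F, rfl⟩ := f.exists_rep
  exact F.lift_off i x hx

theorem Mor.lift_id {i : X.I} {x : E X.dim} (hx : x ∈ (X.chart i).dom) :
    (Mor.id X).lift i x = x :=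
  indicator_of_mem hx _

theorem Mor.nu_of_id {i i' : X.I} {l : PDiffeo X.dim} (hl : l ∈ X.change i i') {x : E X.dim}
    (hx : x ∈ l.source) : (Mor.id X).Nu i i' l x l :=
  ⟨Rep.id X, rfl, ⟨l, hl⟩, hx, EventuallyEq.rfl, EventuallyEq.rfl⟩

/-- The germ of the identity is sent to the germ of the identity. -/
theorem Mor.nu_id (f : Mor X Y) {i : X.I} {x : E X.dim} (hx : x ∈ (X.chart i).dom) :
    f.Nu i i _root_.id x _root_.id := by
  obtain ⟨F, rfl⟩ := f.exists_rep
  have e : ⇑(PDiffeo.idOn (X.chart i).dom (X.chart i).isOpen_dom).toOpenPartialHomeomorph =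
      _root_.id :=
    funext fun y => PDiffeo.idOn_apply _ _ y
  obtain ⟨k, hk, ek, -⟩ := Mor.nu_exists_rep F (isChange_idOn (X.chart i)) (x := x) hx
  rw [e] at ek
  exact ⟨F, rfl, k, hk, ek, F.nu_id k x hk ek⟩

theorem Mor.id_comp (f : Mor X Y) : (Mor.id X).comp f = f := by
  have hl : ((Mor.id X).comp f).lift = f.lift := by
    funext i x
    by_cases hx : x ∈ (X.chart i).dom
    · rw [Mor.lift_comp _ _ _ hx, Mor.lift_id hx]; rfl
    · rw [Mor.lift_of_notMem _ hx, Mor.lift_of_notMem _ hx]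
  refine Mor.ext ?_ (funext fun i => Mor.idx_comp _ _ i) hl fun i i' l hl x hx => ?_
  · rw [Mor.base_comp]; rfl
  · obtain ⟨m, -, n, -⟩ := f.nu_exists hl hx
    refine ⟨m, (Mor.nu_of_id hl hx).comp ?_, n⟩
    rw [Mor.lift_id (IsChange.source_subset hl hx)]
    exact n

theorem Mor.comp_id (f : Mor X Y) : f.comp (Mor.id Y) = f := by
  have hl : (f.comp (Mor.id Y)).lift = f.lift := by
    funext i x
    by_cases hx : x ∈ (X.chart i).dom
    · rw [Mor.lift_comp _ _ _ hx, Mor.lift_id (f.lift_mem hx)]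
    · rw [Mor.lift_of_notMem _ hx, Mor.lift_of_notMem _ hx]
  refine Mor.ext ?_ (funext fun i => Mor.idx_comp _ _ i) hl fun i i' l hl x hx => ?_
  · rw [Mor.base_comp]; rfl
  · obtain ⟨m, hm, n, hs, -⟩ := f.nu_exists hl hx
    exact ⟨m, n.comp (Mor.nu_of_id hm hs), n⟩

theorem Mor.comp_assoc (f : Mor X Y) (g : Mor Y Z) (h : Mor Z T) :
    (f.comp g).comp h = f.comp (g.comp h) := by
  have hl : ((f.comp g).comp h).lift = (f.comp (g.comp h)).lift := by
    funext i x
    by_cases hx : x ∈ (X.chart i).dom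
    · rw [Mor.lift_comp _ _ _ hx, Mor.lift_comp _ _ _ hx, Mor.lift_comp _ _ _ hx,
        Mor.lift_comp _ _ _ (f.lift_mem hx), Mor.idx_comp]
    · rw [Mor.lift_of_notMem _ hx, Mor.lift_of_notMem _ hx]
  refine Mor.ext ?_ (funext fun i => ?_) hl fun i i' l hl x hx => ?_
  · simp only [Mor.base_comp, ContinuousMap.comp_assoc]
  · simp only [Mor.idx_comp]
  · obtain ⟨m, hm, n, hs, -⟩ := f.nu_exists hl hx
    obtain ⟨m', hm', n', hs', -⟩ := g.nu_exists hm hs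
    obtain ⟨m'', -, n'', -⟩ := h.nu_exists hm' hs'
    refine ⟨m'', (n.comp n').comp ?_, n.comp (n'.comp n'')⟩
    rw [Mor.idx_comp, Mor.idx_comp, Mor.lift_comp _ _ _ (IsChange.source_subset hl hx)]
    exact n''

/-! ### Germs of 2-morphisms -/

namespace TwoMor

/-- `m` represents the germ at `f̃ᵢ(x)` of the pieces of the 2-morphism `δ` around `x`. The type of
`m` depends on neither `f` nor `g`, so that germs of 2-morphisms between equal but not
definitionally equal morphisms can be compared. -/
def Germ {f g : Mor X Y} (δ : TwoMor f g) (i : X.I) (x : E X.dim) (m : E Y.dim → E Y.dim) : Prop :=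
  ∃ D : TwoRep f g, Quotient.mk _ D = δ ∧ ∃ p ∈ D.pieces i, x ∈ p.1 ∧
    p.2 =ᶠ[𝓝 (f.lift i x)] m

variable {f g h : Mor X Y} {i : X.I} {x : E X.dim}

theorem exists_germ (δ : TwoMor f g) (hx : x ∈ (X.chart i).dom) :
    ∃ m ∈ Y.change (f.idx i) (g.idx i), δ.Germ i x m ∧ f.lift i x ∈ m.source := by
  obtain ⟨D, rfl⟩ := Quotient.exists_rep δ
  obtain ⟨p, hp, hxp⟩ := D.exists_piece hx
  exact ⟨p.2, D.mem_change i p hp, ⟨D, rfl, p, hp, hxp, EventuallyEq.rfl⟩, D.source i p hp hxp⟩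

theorem Germ.unique {δ : TwoMor f g} {m m' : E Y.dim → E Y.dim} (H : δ.Germ i x m)
    (H' : δ.Germ i x m') : m =ᶠ[𝓝 (f.lift i x)] m' := by
  obtain ⟨D, rfl, p, hp, hx, e⟩ := H
  obtain ⟨D', hD', p', hp', hx', e'⟩ := H'
  have hDD : D.Equiv D' := Quotient.exact hD'.symm
  exact e.symm.trans ((hDD i p hp p' hp' x ⟨hx, hx'⟩).trans e')

theorem Germ.congr {δ : TwoMor f g} {m m' : E Y.dim → E Y.dim} (H : δ.Germ i x m)
    (e : m =ᶠ[𝓝 (f.lift i x)] m') : δ.Germ i x m' := by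
  obtain ⟨D, hD, p, hp, hx, d⟩ := H
  exact ⟨D, hD, p, hp, hx, d.trans e⟩

theorem Germ.apply_eq {δ : TwoMor f g} {m : E Y.dim → E Y.dim} (H : δ.Germ i x m) :
    m (f.lift i x) = g.lift i x := by
  obtain ⟨D, rfl, p, hp, hx, e⟩ := H
  rw [← e.eq_of_nhds, D.lift_eq i p hp x hx]

theorem Germ.continuousAt {δ : TwoMor f g} {m : E Y.dim → E Y.dim} (H : δ.Germ i x m) :
    ContinuousAt m (f.lift i x) := by
  obtain ⟨D, rfl, p, hp, hx, e⟩ := H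
  exact (p.2.continuousAt (D.source i p hp hx)).congr e

/-- A 2-morphism is determined by its germs. -/
theorem ext {δ δ' : TwoMor f g}
    (H : ∀ i, ∀ x ∈ (X.chart i).dom, ∃ m, δ.Germ i x m ∧ δ'.Germ i x m) : δ = δ' := by
  obtain ⟨D, rfl⟩ := Quotient.exists_rep δ
  obtain ⟨D', rfl⟩ := Quotient.exists_rep δ'
  refine Quotient.sound fun i p hp p' hp' x hx => ?_
  obtain ⟨m, n₁, n₂⟩ := H i x (D.subset hp hx.1)
  exact (Germ.unique ⟨D, rfl, p, hp, hx.1, EventuallyEq.rfl⟩ n₁).trans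
    (n₂.unique ⟨D', rfl, p', hp', hx.2, EventuallyEq.rfl⟩)

theorem germ_id (f : Mor X Y) (hx : x ∈ (X.chart i).dom) : (TwoMor.id f).Germ i x _root_.id :=
  ⟨TwoRep.id f, rfl, _, rfl, hx, Eventually.of_forall fun y => PDiffeo.idOn_apply _ _ y⟩

theorem Germ.vcomp {δ : TwoMor f g} {σ : TwoMor g h} {a b : E Y.dim → E Y.dim}
    (H : δ.Germ i x a) (H' : σ.Germ i x b) : (δ.vcomp σ).Germ i x (b ∘ a) := by
  have hy := H.apply_eq
  have hc := H.continuousAt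
  obtain ⟨D, rfl, p, hp, hx, e⟩ := H
  obtain ⟨S, rfl, q, hq, hx', e'⟩ := H'
  obtain ⟨r, ⟨p', q', V⟩, hr⟩ := (D.vcomp S).exists_piece (D.subset hp hx)
  have hs := V.subset hr
  refine ⟨D.vcomp S, rfl, r, ⟨p', q', V⟩, hr, (V.germ hr).trans ?_⟩
  refine (germ_comp_congr hc hy ?_ ?_).symm
  · exact e.symm.trans (D.germ_eq i p hp p' V.left x ⟨hx, hs.1⟩)
  · exact e'.symm.trans (S.germ_eq i q hq q' V.right x ⟨hx', hs.2⟩)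

/-- The germ of `ξ ∗ δ` is the germ of `ξ`, at the image of `x` under the target of `δ`, after the
image of the germ of `δ` under the source of `ξ`. -/
theorem Germ.hcomp {f₁ f₂ : Mor X Y} {g₁ g₂ : Mor Y Z} {δ : TwoMor f₁ f₂} {ξ : TwoMor g₁ g₂}
    {a : E Y.dim → E Y.dim} {n c : E Z.dim → E Z.dim} (H : δ.Germ i x a)
    (N : g₁.Nu (f₁.idx i) (f₂.idx i) a (f₁.lift i x) n)
    (H' : ξ.Germ (f₂.idx i) (f₂.lift i x) c) : (δ.hcomp ξ).Germ i x (c ∘ n) := by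
  obtain ⟨D, rfl, p, hp, hx, e⟩ := H
  obtain ⟨S, rfl, q, hq, hx', e'⟩ := H'
  obtain ⟨r, ⟨p', q', G, d, W, V⟩, hr⟩ := (D.hcomp S).exists_piece (D.subset hp hx)
  obtain ⟨hxd, _, N', hc, hv, he⟩ := V.germ hr
  refine ⟨D.hcomp S, rfl, r, ⟨p', q', G, d, W, V⟩, hr, he.trans ?_⟩
  refine germ_comp_congr hc hv ?_ ?_
  · rw [Mor.lift_comp _ _ _ hxd]
    exact N'.unique N ((D.germ_eq i p' V.left p hp x ⟨V.subset hr, hx⟩).trans e)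
  · exact (S.germ_eq _ q' V.right q hq _ ⟨V.mapsTo hr, hx'⟩).trans e'

/-- Naturality of a 2-morphism with respect to germs of changes of charts. -/
theorem Germ.naturality {δ : TwoMor f g} {i' : X.I} {l : PDiffeo X.dim}
    (hl : l ∈ X.change i i') (hx : x ∈ l.source) {p p' m₁ m₂ : E Y.dim → E Y.dim}
    (H : δ.Germ i x p) (H' : δ.Germ i' (l x) p') (n₁ : f.Nu i i' l x m₁)
    (n₂ : g.Nu i i' l x m₂) : m₂ ∘ p =ᶠ[𝓝 (f.lift i x)] p' ∘ m₁ := by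
  have hy := H.apply_eq
  have hc := H.continuousAt
  obtain ⟨D, rfl, q, hq, hxq, e⟩ := H
  obtain ⟨D', hD', q', hq', hxq', e'⟩ := H'
  obtain ⟨r, hr, hxr⟩ := D.exists_piece (IsChange.map_mem hl hx)
  have hDD : D.Equiv D' := Quotient.exact hD'.symm
  have er := (hDD i' r hr q' hq' _ ⟨hxr, hxq'⟩).trans e'
  obtain ⟨k, -, n, hs, hv⟩ := f.nu_exists hl hx
  have d := n.unique n₁ EventuallyEq.rfl
  have c := D.comm' hq hr hl hx hxq hxr n₁ n₂
  refine (germ_comp_congr hc hy e.symm EventuallyEq.rfl).trans (c.trans ?_)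
  refine germ_comp_congr ((k.continuousAt hs).congr d) ?_ EventuallyEq.rfl er
  rw [← d.eq_of_nhds, hv]

/-- The germ of `g ∗ δ`, for a morphism `g` and a 2-morphism `δ`. -/
theorem Germ.hcomp_id {f₁ f₂ : Mor X Y} (g : Mor Y Z) {δ : TwoMor f₁ f₂}
    {a : E Y.dim → E Y.dim} {n : E Z.dim → E Z.dim} (hx : x ∈ (X.chart i).dom) (H : δ.Germ i x a)
    (N : g.Nu (f₁.idx i) (f₂.idx i) a (f₁.lift i x) n) :
    (δ.hcomp (TwoMor.id g)).Germ i x n :=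
  H.hcomp (c := _root_.id) N (germ_id g (f₂.lift_mem hx))

/-- The germ of `ξ ∗ f`, for a morphism `f` and a 2-morphism `ξ`. -/
theorem Germ.id_hcomp (f : Mor X Y) {g₁ g₂ : Mor Y Z} {ξ : TwoMor g₁ g₂}
    {c : E Z.dim → E Z.dim} (hx : x ∈ (X.chart i).dom) (H : ξ.Germ (f.idx i) (f.lift i x) c) :
    ((TwoMor.id f).hcomp ξ).Germ i x c :=
  Germ.hcomp (n := _root_.id) (germ_id f hx) (g₁.nu_id (f.lift_mem hx)) H

theorem id_vcomp (δ : TwoMor f g) : (TwoMor.id f).vcomp δ = δ :=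
  ext fun i x hx => by
    obtain ⟨m, -, H, -⟩ := δ.exists_germ hx
    exact ⟨m, (germ_id f hx).vcomp H, H⟩

theorem vcomp_id (δ : TwoMor f g) : δ.vcomp (TwoMor.id g) = δ :=
  ext fun i x hx => by
    obtain ⟨m, -, H, -⟩ := δ.exists_germ hx
    exact ⟨m, H.vcomp (germ_id g hx), H⟩

theorem vcomp_assoc {k : Mor X Y} (δ : TwoMor f g) (σ : TwoMor g h) (τ : TwoMor h k) :
    (δ.vcomp σ).vcomp τ = δ.vcomp (σ.vcomp τ) :=
  ext fun i x hx => by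
    obtain ⟨a, -, A, -⟩ := δ.exists_germ hx
    obtain ⟨b, -, B, -⟩ := σ.exists_germ hx
    obtain ⟨c, -, C, -⟩ := τ.exists_germ hx
    exact ⟨c ∘ b ∘ a, (A.vcomp B).vcomp C, A.vcomp (B.vcomp C)⟩

/-- The interchange law: by naturality of `ξ`, the germs of `ν_{g₂}(σ) ∘ ξ` and `ξ ∘ ν_{g₁}(σ)`
agree. -/
theorem interchange {f₁ f₂ f₃ : Mor X Y} {g₁ g₂ g₃ : Mor Y Z} (δ : TwoMor f₁ f₂)
    (σ : TwoMor f₂ f₃) (ξ : TwoMor g₁ g₂) (η : TwoMor g₂ g₃) :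
    (δ.vcomp σ).hcomp (ξ.vcomp η) = (δ.hcomp ξ).vcomp (σ.hcomp η) :=
  ext fun i x hx => by
    obtain ⟨a, ha, A, has⟩ := δ.exists_germ hx
    obtain ⟨b, hb, B, hbs⟩ := σ.exists_germ hx
    obtain ⟨c, -, C, -⟩ := ξ.exists_germ (f₂.lift_mem hx)
    obtain ⟨c', -, C', -⟩ := ξ.exists_germ (f₃.lift_mem hx)
    obtain ⟨e, -, H, -⟩ := η.exists_germ (f₃.lift_mem hx)
    obtain ⟨m, -, M, hm, hmv⟩ := g₁.nu_exists ha has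
    obtain ⟨n, -, N, -⟩ := g₁.nu_exists hb hbs
    obtain ⟨n', -, N', -⟩ := g₂.nu_exists hb hbs
    -- `k` is a change of charts with the germ of `b ∘ a`, so that `ν_{g₁}` is defined on this germ
    obtain ⟨k, hk, hks, -, hke⟩ := IsChange.exists_comp ha hb has (A.apply_eq ▸ hbs) univ_mem
    have ek := hke.eventuallyEq_of_mem (k.mem_nhds hks)
    obtain ⟨r, -, R, -⟩ := g₁.nu_exists hk hks
    have er := M.comp_eq (A.apply_eq.symm ▸ N) R ek
    have hnat := C.naturality hb hbs (B.apply_eq.symm ▸ C') N N'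
    have hlc := Mor.lift_comp f₁ g₁ i hx
    refine ⟨(e ∘ n') ∘ c ∘ m, ?_, (A.hcomp M C).vcomp (B.hcomp N' H)⟩
    refine ((A.vcomp B).hcomp (R.congr ek EventuallyEq.rfl) (C'.vcomp H)).congr ?_
    rw [hlc]
    have hm' : m (g₁.lift (f₁.idx i) (f₁.lift i x)) = g₁.lift (f₂.idx i) (f₂.lift i x) := by
      rw [hmv, A.apply_eq]
    have hmc := m.continuousAt hm
    have hnat' : ∀ᶠ z in 𝓝 (g₁.lift (f₁.idx i) (f₁.lift i x)), (n' ∘ c) (m z) = (c' ∘ n) (m z) :=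
      hmc.eventually (hm'.symm ▸ hnat)
    filter_upwards [er, hnat'] with z h1 h2
    simp only [Function.comp] at h1 h2 ⊢
    rw [h1, h2]

end TwoMor

/-! ### The 2-category -/

/-- The category of morphisms `X ⟶ Y` and 2-morphisms between them, under vertical composition. -/
@[reducible]
noncomputable def Mor.category (X Y : RedAtl.{u}) : Category.{u} (Mor X Y) where
  Hom := TwoMor
  id := TwoMor.id
  comp δ σ := δ.vcomp σ
  id_comp := TwoMor.id_vcomp
  comp_id := TwoMor.vcomp_id
  assoc := TwoMor.vcomp_assoc

attribute [local instance] Mor.category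

section

variable {f f' g g' : Mor X Y} {i : X.I} {x : E X.dim}

/-- The 2-morphism given by an equality of morphisms consists of germs of the identity. -/
theorem TwoMor.germ_eqToHom (e : f = g) (hx : x ∈ (X.chart i).dom) :
    TwoMor.Germ (eqToHom e) i x _root_.id := by
  subst e
  exact TwoMor.germ_id f hx

theorem TwoMor.germ_eqToHom_hcomp_id (e : f = g) (k : Mor Y Z) (hx : x ∈ (X.chart i).dom) :
    (TwoMor.hcomp (eqToHom e) (TwoMor.id k)).Germ i x _root_.id := by
  subst e
  exact (TwoMor.germ_id f hx).hcomp_id k hx (k.nu_id (f.lift_mem hx))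

theorem TwoMor.Germ.eqToHom_comp {m : E Y.dim → E Y.dim} (e : f = f') {η : f' ⟶ g}
    (H : TwoMor.Germ η i x m) : TwoMor.Germ (eqToHom e ≫ η) i x m := by
  subst e
  rwa [eqToHom_refl, Category.id_comp]

theorem TwoMor.Germ.comp_eqToHom {m : E Y.dim → E Y.dim} (e : g' = g) {η : f ⟶ g'}
    (H : TwoMor.Germ η i x m) : TwoMor.Germ (η ≫ eqToHom e) i x m := by
  subst e
  rwa [eqToHom_refl, Category.comp_id]

/-- Composition with equalities of morphisms does not change germs. -/
theorem TwoMor.Germ.conj_eqToHom {m : E Y.dim → E Y.dim} (e : f = f') (e' : g' = g)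
    {η : f' ⟶ g'} (H : TwoMor.Germ η i x m) :
    TwoMor.Germ (eqToHom e ≫ η ≫ eqToHom e') i x m :=
  (H.comp_eqToHom e').eqToHom_comp e

end

/-- The bicategory of reduced orbifold atlases. The associator and the unitors come from equalities
of morphisms. -/
@[reducible]
noncomputable def RedAtl.bicategory : Bicategory.{u, u, u + 1} RedAtl.{u} where
  Hom := Mor
  id := Mor.id
  comp f g := f.comp g
  homCategory X Y := Mor.category X Y
  whiskerLeft f _ _ η := (TwoMor.id f).hcomp η
  whiskerRight η h := TwoMor.hcomp η (TwoMor.id h)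
  associator f g h := eqToIso (Mor.comp_assoc f g h)
  leftUnitor f := eqToIso (Mor.id_comp f)
  rightUnitor f := eqToIso (Mor.comp_id f)
  whiskerLeft_id f g := TwoMor.ext fun i x hx =>
    ⟨_root_.id, TwoMor.Germ.id_hcomp f hx (TwoMor.germ_id g (f.lift_mem hx)),
      TwoMor.germ_id _ hx⟩
  whiskerLeft_comp f g h k η θ := TwoMor.ext fun i x hx => by
    obtain ⟨a, -, A, -⟩ := TwoMor.exists_germ η (f.lift_mem hx)
    obtain ⟨b, -, B, -⟩ := TwoMor.exists_germ θ (f.lift_mem hx)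
    exact ⟨b ∘ a, TwoMor.Germ.id_hcomp f hx (A.vcomp B),
      (A.id_hcomp f hx).vcomp (B.id_hcomp f hx)⟩
  id_whiskerLeft η := TwoMor.ext fun i x hx => by
    obtain ⟨a, -, A, -⟩ := TwoMor.exists_germ η hx
    refine ⟨a, TwoMor.Germ.id_hcomp _ hx ?_, A.conj_eqToHom (Mor.id_comp _) (Mor.id_comp _).symm⟩
    rw [Mor.lift_id hx]
    exact A
  comp_whiskerLeft f g h h' η := TwoMor.ext fun i x hx => by
    obtain ⟨a, -, A, -⟩ := TwoMor.exists_germ η (g.lift_mem (f.lift_mem hx))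
    refine ⟨a, TwoMor.Germ.id_hcomp _ hx ?_,
      ((A.id_hcomp g (f.lift_mem hx)).id_hcomp f hx).conj_eqToHom
        (Mor.comp_assoc f g h) (Mor.comp_assoc f g h').symm⟩
    rw [Mor.lift_comp _ _ _ hx, Mor.idx_comp]
    exact A
  id_whiskerRight f g := TwoMor.ext fun i x hx =>
    ⟨_root_.id, (TwoMor.germ_id f hx).hcomp_id g hx (g.nu_id (f.lift_mem hx)),
      TwoMor.germ_id _ hx⟩
  comp_whiskerRight {X Y Z f g h} η θ k := by
    have := TwoMor.interchange η θ (TwoMor.id k) (TwoMor.id k)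
    rwa [TwoMor.id_vcomp] at this
  whiskerRight_id {X Y f g} η := TwoMor.ext fun i x hx => by
    obtain ⟨a, ha, A, has⟩ := TwoMor.exists_germ η hx
    exact ⟨a, A.hcomp_id _ hx (Mor.nu_of_id ha has),
      A.conj_eqToHom (Mor.comp_id _) (Mor.comp_id _).symm⟩
  whiskerRight_comp η g h := TwoMor.ext fun i x hx => by
    obtain ⟨a, ha, A, has⟩ := TwoMor.exists_germ η hx
    obtain ⟨m, hm, M, hms, -⟩ := Mor.nu_exists g ha has
    obtain ⟨n, -, N, -⟩ := Mor.nu_exists h hm hms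
    refine ⟨n, A.hcomp_id _ hx (M.comp N),
      ((A.hcomp_id g hx M).hcomp_id h hx ?_).conj_eqToHom (Mor.comp_assoc _ g h).symm
        (Mor.comp_assoc _ g h)⟩
    rw [Mor.lift_comp _ _ _ hx, Mor.idx_comp, Mor.idx_comp]
    exact N
  whisker_assoc f g g' η h := TwoMor.ext fun i x hx => by
    obtain ⟨a, ha, A, has⟩ := TwoMor.exists_germ η (f.lift_mem hx)
    obtain ⟨n, -, N, -⟩ := Mor.nu_exists h ha has
    refine ⟨n, (A.id_hcomp f hx).hcomp_id h hx ?_,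
      ((A.hcomp_id h (f.lift_mem hx) N).id_hcomp f hx).conj_eqToHom (Mor.comp_assoc f g h)
        (Mor.comp_assoc f g' h).symm⟩
    rw [Mor.lift_comp _ _ _ hx, Mor.idx_comp, Mor.idx_comp]
    exact N
  whisker_exchange {X Y Z f g h k} η θ := by
    have e₁ := TwoMor.interchange (TwoMor.id f) η θ (TwoMor.id k)
    have e₂ := TwoMor.interchange η (TwoMor.id g) (TwoMor.id h) θ
    rw [TwoMor.id_vcomp, TwoMor.vcomp_id] at e₁ e₂
    exact e₁.symm.trans e₂
  pentagon f g h k := TwoMor.ext fun i x hx =>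
    ⟨_root_.id ∘ _root_.id,
      (TwoMor.germ_eqToHom_hcomp_id (Mor.comp_assoc f g h) k hx).vcomp
        (((TwoMor.germ_eqToHom (Mor.comp_assoc g h k) (f.lift_mem hx)).id_hcomp f hx).eqToHom_comp
          (Mor.comp_assoc f (g.comp h) k)),
      (TwoMor.germ_eqToHom (Mor.comp_assoc (f.comp g) h k) hx).vcomp
        (TwoMor.germ_eqToHom (Mor.comp_assoc f g (h.comp k)) hx)⟩
  triangle f g := TwoMor.ext fun i x hx =>
    ⟨_root_.id,
      ((TwoMor.germ_eqToHom (Mor.id_comp g) (f.lift_mem hx)).id_hcomp f hx).eqToHom_comp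
        (Mor.comp_assoc f (Mor.id _) g),
      TwoMor.germ_eqToHom_hcomp_id (Mor.comp_id f) g hx⟩

theorem RedAtl.strict : @Bicategory.Strict RedAtl.{u} RedAtl.bicategory :=
  letI := RedAtl.bicategory.{u}
  { id_comp := fun f => Mor.id_comp f
    comp_id := fun f => Mor.comp_id f
    assoc := fun f g h => Mor.comp_assoc f g h
    leftUnitor_eqToIso := fun _ => rfl
    rightUnitor_eqToIso := fun _ => rfl
    associator_eqToIso := fun _ _ _ => rfl }

end Orbifold

theorem mainTheorem5 :
    (∃ (B : Bicategory.{u, u, u + 1} RedAtl.{u})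
      (hom : ∀ {X Y : RedAtl.{u}}, Mor X Y ≃ (X ⟶ Y))
      (hom₂ : ∀ {X Y : RedAtl.{u}} {f g : Mor X Y}, TwoMor f g ≃ (hom f ⟶ hom g))
      (hom_comp : ∀ {X Y Z : RedAtl.{u}} (f : Mor X Y) (g : Mor Y Z),
        hom (f.comp g) = hom f ≫ hom g),
      Bicategory.Strict RedAtl.{u} ∧
      (∀ X : RedAtl.{u}, hom (Mor.id X) = 𝟙 X) ∧
      (∀ {X Y : RedAtl.{u}} (f : Mor X Y), hom₂ (TwoMor.id f) = 𝟙 (hom f)) ∧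
      (∀ {X Y : RedAtl.{u}} {f g h : Mor X Y} (δ : TwoMor f g) (σ : TwoMor g h),
        hom₂ (δ.vcomp σ) = hom₂ δ ≫ hom₂ σ) ∧
      (∀ {X Y Z : RedAtl.{u}} {f₁ f₂ : Mor X Y} {g₁ g₂ : Mor Y Z}
        (δ : TwoMor f₁ f₂) (ξ : TwoMor g₁ g₂),
        hom₂ (δ.hcomp ξ) = eqToHom (hom_comp f₁ g₁) ≫
          (hom₂ δ ▷ hom g₁ ≫ hom f₂ ◁ hom₂ ξ) ≫ eqToHom (hom_comp f₂ g₂).symm)) ∧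
    (∀ {X Y Z : RedAtl.{u}} {f₁ f₂ f₃ : Mor X Y} {g₁ g₂ g₃ : Mor Y Z}
      (δ : TwoMor f₁ f₂) (σ : TwoMor f₂ f₃) (ξ : TwoMor g₁ g₂) (η : TwoMor g₂ g₃),
      (δ.vcomp σ).hcomp (ξ.vcomp η) = (δ.hcomp ξ).vcomp (σ.hcomp η)) := by
  refine ⟨⟨RedAtl.bicategory, @fun X Y => Equiv.refl (Mor X Y),
    @fun X Y f g => Equiv.refl (TwoMor f g), fun _ _ => rfl, RedAtl.strict,
    fun _ => rfl, fun _ => rfl, fun _ _ => rfl, fun {X Y Z f₁ f₂ g₁ g₂} δ ξ => ?_⟩,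
    TwoMor.interchange⟩
  -- `ξ ∗ δ` is the vertical composition of the whiskerings, by interchange with identities
  have e := TwoMor.interchange δ (TwoMor.id f₂) (TwoMor.id g₁) ξ
  rw [TwoMor.vcomp_id, TwoMor.id_vcomp] at e
  refine e.trans ?_
  -- the composition of morphisms in the bicategory is `Mor.comp`, so both `eqToHom` are identities
  exact ((TwoMor.id_vcomp _).trans (TwoMor.vcomp_id _)).symm
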